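/- Let $k\ge 1$, $0<\delta<1/k$ and $0<\pi^*\le 1/k$. A Markov chain on $[k]=\{1,\dots,k\}$ is given by an initial distribution $\mu$ and a transition matrix $M$. Let $\mathbb M^k_{\delta,\pi^*}$ be the set of all Markov chains $(\mu,M)$ on $[k]$ ($\mu$ arbitrary) with $M_{ij}\ge\delta$ for all $i,j$ whose (unique) stationary distribution $\pi$ satisfies $\min_i\pi_i=\pi^*$, and assume that this set is non-empty (for $k\ge2$ this means $\pi^*\ge\delta$; for $k=1$ it means $\pi^*=1$). Let $f$ be convex on $(0,\infty)$ with $f(1)=0$, thrice continuously differentiable on $(0,\infty)$, with $\lim_{x\to\infty}|f(x)|/e^{cx}=0$ for all $c>0$ and $f''(1)\neq0$, and let $D_f(p,q)=\sum_{i\in[k]}q(i)f(p(i)/q(i))$, where $f(0)=\lim_{x\to0^+}f(x)$, $0f(a/0)=a\lim_{x\to\infty}f(x)/x$ and $0f(0/0)=0$. An estimator $\hat M$ maps every sample sequence $x^n\in[k]^n$ to a transition matrix $\hat M_{x^n}$. Define \[ \varepsilon_n^f=\inf_{\hat M}\ \sup_{(\mu,M)\in\mathbb M^k_{\delta,\pi^*}}\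 \max_{i\in[k]}\mathbb E_{X^n\sim(\mu,M)}\bigl[D_f(M(i,\cdot),\hat M_{X^n}(i,\cdot))\bigr], \] \[ \tilde\varepsilon_n^f=\inf_{\hat M}\ \sup_{(\mu,M)\in\mathbb M^k_{\delta,\pi^*}}\ \sum_{i\in[k]}\pi_i\,\mathbb E_{X^n\sim(\mu,M)}\bigl[D_f(M(i,\cdot),\hat M_{X^n}(i,\cdot))\bigr]. \] Write $a_n\lesssim b_n$ if $a_n\le b_n(1+o(1))$ as $n\to\infty$, with $k,\delta,\pi^*,f$ fixed. Then \[ (1-\pi^*)\frac{(k-2)kf''(1)}{2n}\lesssim\tilde\varepsilon_n^f\lesssim\frac{(k-1)kf''(1)}{2n} \] and \[ (1-\pi^*)\frac{(k-2)f''(1)}{2n\pi^*}\lesssim\varepsilon_n^f\lesssim\frac{(k-1)f''(1)}{2n\pi^*}. \] -/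

import Mathlib

open Set Filter Topology

noncomputable section

/-- `f` generates an ordinary `f`-divergence: `f` is convex on `(0, ∞)`, `f 1 = 0`, `f` is thrice
continuously differentiable on `(0, ∞)`, sub-exponential, and `f'' 1 ≠ 0`. Only the values of `f`
on `(0, ∞)` matter. -/
structure IsOrdinary (f : ℝ → ℝ) : Prop where
  convexOn : ConvexOn ℝ (Ioi 0) f
  map_one : f 1 = 0
  contDiffOn : ContDiffOn ℝ 3 f (Ioi 0)
  subexp : ∀ c : ℝ, 0 < c → Tendsto (fun x : ℝ => |f x| / Real.exp (c * x)) atTop (𝓝 0)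
  deriv_two_ne : iteratedDeriv 2 f 1 ≠ 0

/-- The summand `q f(p / q)` of an `f`-divergence, with the usual conventions for zero
probabilities: `f(0) = lim_{x → 0+} f(x)`, `0 f(p / 0) = p lim_{x → ∞} f(x) / x` and `0 f(0 / 0) = 0`.
(For convex `f` both limits exist in `(-∞, ∞]`, so each `limsup` is a limit.) -/
def fDivTerm (f : ℝ → ℝ) (p q : ℝ) : EReal :=
  if q = 0 then (p : EReal) * limsup (fun x : ℝ => ((f x / x : ℝ) : EReal)) atTop
  else if p = 0 then (q : EReal) * limsup (fun x : ℝ => (f x : EReal)) (𝓝[>] 0)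
  else ((q * f (p / q) : ℝ) : EReal)

/-- The `f`-divergence between two distributions on `Fin k`. -/
def fDiv {k : ℕ} (f : ℝ → ℝ) (p q : Fin k → ℝ) : EReal :=
  ∑ i, fDivTerm f (p i) (q i)

/-- A Markov chain model on `Fin k`: an initial distribution, a transition matrix, and a
stationary distribution of that matrix (which is determined by the matrix when all
entries of the matrix are positive). -/
structure MarkovModel (k : ℕ) where
  init : Fin k → ℝ
  trans : Matrix (Fin k) (Fin k) ℝ
  stat : Fin k → ℝ
  init_mem : init ∈ stdSimplex ℝ (Fin k)
  trans_mem : trans ∈ Matrix.rowStochastic ℝ (Fin k)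
  stat_mem : stat ∈ stdSimplex ℝ (Fin k)
  stat_eq : Matrix.vecMul stat trans = stat

/-- The probability that the first `n` samples of the chain are `x`. -/
def MarkovModel.pathProb {k : ℕ} (P : MarkovModel k) : (n : ℕ) → (Fin n → Fin k) → ℝ
  | 0, _ => 1
  | m + 1, x => P.init (x 0) * ∏ t : Fin m, P.trans (x t.castSucc) (x t.succ)

/-- An estimator from `n` samples: a transition matrix for every sample sequence. -/
abbrev Estimator (n k : ℕ) : Type := (Fin n → Fin k) → Matrix.rowStochastic ℝ (Fin k)

/-- The expected loss, under `P`, of the estimator in row `i`. -/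
def stateRisk {n k : ℕ} (L : (Fin k → ℝ) → (Fin k → ℝ) → EReal) (P : MarkovModel k)
    (E : Estimator n k) (i : Fin k) : EReal :=
  ∑ x : Fin n → Fin k, (P.pathProb n x : EReal) * L (P.trans i) ((E x).1 i)

/-- The worst-state estimation risk. -/
def worstRisk {n k : ℕ} (L : (Fin k → ℝ) → (Fin k → ℝ) → EReal) (P : MarkovModel k)
    (E : Estimator n k) : EReal :=
  ⨆ i : Fin k, stateRisk L P E i

/-- The stationary-weighted estimation risk. -/
def weightedRisk {n k : ℕ} (L : (Fin k → ℝ) → (Fin k → ℝ) → EReal) (P : MarkovModel k)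
    (E : Estimator n k) : EReal :=
  ∑ i : Fin k, (P.stat i : EReal) * stateRisk L P E i

/-- The minimax worst-state estimation risk over a class of chains, from `n` samples. -/
def minimaxWorst {k : ℕ} (L : (Fin k → ℝ) → (Fin k → ℝ) → EReal) (S : Set (MarkovModel k))
    (n : ℕ) : EReal :=
  ⨅ E : Estimator n k, ⨆ P ∈ S, worstRisk L P E

/-- The minimax stationary-weighted estimation risk over a class of chains, from `n` samples. -/
def minimaxWeighted {k : ℕ} (L : (Fin k → ℝ) → (Fin k → ℝ) → EReal) (S : Set (MarkovModel k))
    (n : ℕ) : EReal :=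
  ⨅ E : Estimator n k, ⨆ P ∈ S, weightedRisk L P E

/-- The chains on `Fin k`, with any initial distribution, all of whose transition
probabilities are at least `δ` and whose smallest stationary probability is `ρ`. -/
def chainClass (k : ℕ) (δ ρ : ℝ) : Set (MarkovModel k) :=
  {P | (∀ i j, δ ≤ P.trans i j) ∧ IsLeast (Set.range P.stat) ρ}

/-- `a ≲ b`: `a ≤ b (1 + o(1))` as `n → ∞`. -/
def AsympLE (a b : ℕ → EReal) : Prop :=
  ∃ o : ℕ → ℝ, Tendsto o atTop (𝓝 0) ∧ ∀ᶠ n in atTop, a n ≤ b n * ((1 + o n : ℝ) : EReal)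

end

/-!
Near the diagonal an `f`-divergence is `f''(1) / 2` times the `χ²`-divergence, so both minimax risks
reduce to the squared errors of the single entries of the transition matrix.

Upper bounds: estimate the matrix by its empirical transition frequencies, truncated below. The
deviations `N(i, j) - M(i, j) N(i)` of the transition counts are sums of martingale differences with
total variance `π(i) M(i, j) (1 - M(i, j)) n`, up to `O(1)`, and Azuma–Hoeffding makes deviations
of order `n` exponentially unlikely. The visit counts `N(i)` concentrate at `π(i) n` because the
matrix contracts oscillations. Summing the variances, relative to `M(i, j)`, over `j` gives the
factor `k - 1`.

Lower bounds: perturb the chain that draws independent samples from the uniform distribution if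
`π* = 1 / k`, and otherwise from the distribution with mass `π*` at one state `z` that is uniform on
the other states. In the second case the directions of perturbation avoid the column `z`, so that
the smallest stationary probability remains `π*`; this costs one degree of freedom and leaves
`k - 2`. Each entry is then bounded by the van Trees inequality along a line through the parameter
box, with a prior of density proportional to `(e² - t²)²`.
-/

noncomputable section

section Paths

variable {α : Type*}

/-- The probability of a path with `m` transitions, for initial weights `b` and transition
weights `M`. -/
def pathWeight (b : α → ℝ) (M : α → α → ℝ) (m : ℕ) (x : Fin (m + 1) → α) : ℝ :=
  b (x 0) * ∏ t : Fin m, M (x t.castSucc) (x t.succ)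

/-- The mean of a function of a path with `m` transitions. -/
def pathMean [Fintype α] (b : α → ℝ) (M : α → α → ℝ) (m : ℕ) (F : (Fin (m + 1) → α) → ℝ) : ℝ :=
  ∑ x, pathWeight b M m x * F x

/-- The sum of `φ` over the transitions of a path. -/
def transSum (φ : α → α → ℝ) {m : ℕ} (x : Fin (m + 1) → α) : ℝ :=
  ∑ t : Fin m, φ (x t.castSucc) (x t.succ)

variable {b : α → ℝ} {M : α → α → ℝ} {m : ℕ}

theorem pathWeight_snoc (y : Fin (m + 1) → α) (j : α) :
    pathWeight b M (m + 1) (Fin.snoc (α := fun _ => α) y j) =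
      pathWeight b M m y * M (y (Fin.last m)) j := by
  have hzero : Fin.snoc (α := fun _ => α) y j 0 = y 0 := Fin.snoc_castSucc (i := 0) ..
  simp only [pathWeight, Fin.prod_univ_castSucc, ← Fin.castSucc_succ, Fin.succ_last,
    Fin.snoc_castSucc, Fin.snoc_last, hzero, mul_assoc]

theorem transSum_snoc (φ : α → α → ℝ) (y : Fin (m + 1) → α) (j : α) :
    transSum φ (Fin.snoc (α := fun _ => α) y j) = transSum φ y + φ (y (Fin.last m)) j := by
  simp only [transSum, Fin.sum_univ_castSucc, ← Fin.castSucc_succ, Fin.succ_last,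
    Fin.snoc_castSucc, Fin.snoc_last]

theorem pathWeight_nonneg (hb : ∀ i, 0 ≤ b i) (hM : ∀ i j, 0 ≤ M i j) (x : Fin (m + 1) → α) :
    0 ≤ pathWeight b M m x :=
  mul_nonneg (hb _) (Finset.prod_nonneg fun _ _ => hM _ _)

variable [Fintype α]

theorem pathMean_zero (F : (Fin 1 → α) → ℝ) :
    pathMean b M 0 F = ∑ i, b i * F fun _ => i := by
  simp only [pathMean, pathWeight, Finset.univ_eq_empty, Finset.prod_empty, mul_one]
  rw [← (Equiv.funUnique (Fin 1) α).symm.sum_comp]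
  rfl

theorem pathMean_succ (F : (Fin (m + 2) → α) → ℝ) :
    pathMean b M (m + 1) F =
      pathMean b M m fun y => ∑ j, M (y (Fin.last m)) j * F (Fin.snoc (α := fun _ => α) y j) := by
  simp only [pathMean, Finset.mul_sum, ← mul_assoc, ← pathWeight_snoc]
  rw [← (Fin.snocEquiv fun _ : Fin (m + 2) => α).sum_comp, Fintype.sum_prod_type,
    Finset.sum_comm]
  rfl

theorem pathMean_add (F G : (Fin (m + 1) → α) → ℝ) :
    pathMean b M m (fun x => F x + G x) = pathMean b M m F + pathMean b M m G := by
  simp only [pathMean, mul_add, Finset.sum_add_distrib]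

theorem pathMean_sub (F G : (Fin (m + 1) → α) → ℝ) :
    pathMean b M m (fun x => F x - G x) = pathMean b M m F - pathMean b M m G := by
  simp only [pathMean, mul_sub, Finset.sum_sub_distrib]

theorem pathMean_const_mul (c : ℝ) (F : (Fin (m + 1) → α) → ℝ) :
    pathMean b M m (fun x => c * F x) = c * pathMean b M m F := by
  simp only [pathMean, Finset.mul_sum, mul_left_comm]

theorem pathMean_sum {ι : Type*} (s : Finset ι) (F : ι → (Fin (m + 1) → α) → ℝ) :
    pathMean b M m (fun x => ∑ i ∈ s, F i x) = ∑ i ∈ s, pathMean b M m (F i) := by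
  simp only [pathMean, Finset.mul_sum]
  exact Finset.sum_comm

theorem pathMean_const (hb : ∑ i, b i = 1) (hM : ∀ i, ∑ j, M i j = 1) (c : ℝ) :
    pathMean b M m (fun _ => c) = c := by
  induction m with
  | zero => simp [pathMean_zero, ← Finset.sum_mul, hb]
  | succ m ih => simpa [pathMean_succ, ← Finset.sum_mul, hM] using ih

theorem pathMean_transSum_succ (φ : α → α → ℝ) (hM : ∀ i, ∑ j, M i j = 1) :
    pathMean b M (m + 1) (transSum φ) =
      pathMean b M m (transSum φ) + pathMean b M m fun y =>
        ∑ j, M (y (Fin.last m)) j * φ (y (Fin.last m)) j := by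
  simp only [pathMean_succ, ← pathMean_add, transSum_snoc, mul_add, Finset.sum_add_distrib,
    ← Finset.sum_mul, hM, one_mul]

theorem pathMean_transSum_eq_zero (φ : α → α → ℝ) (hM : ∀ i, ∑ j, M i j = 1)
    (hφ : ∀ i, ∑ j, M i j * φ i j = 0) : pathMean b M m (transSum φ) = 0 := by
  induction m with
  | zero => simp [pathMean, transSum]
  | succ m ih =>
    rw [pathMean_transSum_succ _ hM, ih]
    simp only [hφ, pathMean, mul_zero, Finset.sum_const_zero, add_zero]

/-- The increments of a martingale are uncorrelated. -/
theorem pathMean_transSum_sq (φ : α → α → ℝ) (hM : ∀ i, ∑ j, M i j = 1)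
    (hφ : ∀ i, ∑ j, M i j * φ i j = 0) :
    pathMean b M m (fun x => transSum φ x ^ 2) =
      pathMean b M m (transSum fun i _ => ∑ j, M i j * φ i j ^ 2) := by
  have sum_sq (s : ℝ) (i : α) :
      ∑ j, M i j * (s + φ i j) ^ 2 = s ^ 2 + ∑ j, M i j * φ i j ^ 2 := by
    calc ∑ j, M i j * (s + φ i j) ^ 2
        = s ^ 2 * ∑ j, M i j + 2 * s * ∑ j, M i j * φ i j + ∑ j, M i j * φ i j ^ 2 := by
          simp only [Finset.mul_sum, ← Finset.sum_add_distrib]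
          exact Finset.sum_congr rfl fun j _ => by ring
      _ = _ := by rw [hM, hφ]; ring
  induction m with
  | zero => simp [pathMean, transSum]
  | succ m ih =>
    rw [pathMean_transSum_succ _ hM, ← ih, pathMean_succ, ← pathMean_add]
    simp only [transSum_snoc, sum_sq, ← Finset.sum_mul, hM, one_mul]

theorem pathMean_mono (hb : ∀ i, 0 ≤ b i) (hM : ∀ i j, 0 ≤ M i j)
    {F G : (Fin (m + 1) → α) → ℝ} (h : ∀ x, F x ≤ G x) :
    pathMean b M m F ≤ pathMean b M m G :=
  Finset.sum_le_sum fun x _ => mul_le_mul_of_nonneg_left (h x) (pathWeight_nonneg hb hM x)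

theorem pathMean_last_le (hb : b ∈ stdSimplex ℝ α) (hM : ∀ i, M i ∈ stdSimplex ℝ α)
    (ψ : α → ℝ) {B : ℝ} (hψb : ∑ i, b i * ψ i ≤ B) (hψM : ∀ i, ∑ j, M i j * ψ j ≤ B) :
    pathMean b M m (fun x => ψ (x (Fin.last m))) ≤ B := by
  cases m with
  | zero => simpa only [pathMean_zero] using hψb
  | succ m =>
    simp only [pathMean_succ, Fin.snoc_last]
    calc _ ≤ pathMean b M m fun _ => B := pathMean_mono hb.1 (fun i => (hM i).1) fun _ => hψM _
      _ = B := pathMean_const hb.2 (fun i => (hM i).2) B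

theorem pathMean_transSum_le (hb : b ∈ stdSimplex ℝ α) (hM : ∀ i, M i ∈ stdSimplex ℝ α)
    (ψ : α → ℝ) {B : ℝ} (hψb : ∑ i, b i * ψ i ≤ B) (hψM : ∀ i, ∑ j, M i j * ψ j ≤ B) :
    pathMean b M m (transSum fun i _ => ψ i) ≤ m * B := by
  induction m with
  | zero => simp [pathMean, transSum]
  | succ m ih =>
    rw [pathMean_transSum_succ _ fun i => (hM i).2]
    simp only [← Finset.sum_mul, (hM _).2, one_mul]
    push_cast
    linarith [pathMean_last_le (m := m) hb hM ψ hψb hψM]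

theorem hoeffding_sum_mul_exp_le {p φ : α → ℝ} (hp : p ∈ stdSimplex ℝ α) (hφ : ∑ j, p j * φ j = 0)
    (hφ_le : ∀ j, |φ j| ≤ 1) (l : ℝ) :
    ∑ j, p j * Real.exp (φ j * l) ≤ Real.exp (l ^ 2 / 2) := by
  calc ∑ j, p j * Real.exp (φ j * l)
      ≤ ∑ j, p j * (Real.cosh l + φ j * Real.sinh l) :=
        Finset.sum_le_sum fun j _ => mul_le_mul_of_nonneg_left
          (Real.exp_mul_le_cosh_add_mul_sinh (hφ_le j) l) (hp.1 j)
    _ = (∑ j, p j) * Real.cosh l + (∑ j, p j * φ j) * Real.sinh l := by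
        simp only [mul_add, Finset.sum_add_distrib, Finset.sum_mul, mul_assoc]
    _ = Real.cosh l := by rw [hp.2, hφ]; ring
    _ ≤ Real.exp (l ^ 2 / 2) := Real.cosh_le_exp_half_sq l

theorem pathMean_exp_transSum_le (hb : b ∈ stdSimplex ℝ α) (hM : ∀ i, M i ∈ stdSimplex ℝ α)
    {φ : α → α → ℝ} (hφ : ∀ i, ∑ j, M i j * φ i j = 0) (hφ_le : ∀ i j, |φ i j| ≤ 1) (l : ℝ) :
    pathMean b M m (fun x => Real.exp (transSum φ x * l)) ≤ Real.exp (m * (l ^ 2 / 2)) := by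
  have hM0 : ∀ i j, 0 ≤ M i j := fun i => (hM i).1
  induction m with
  | zero => simpa [transSum] using (pathMean_const (m := 0) hb.2 (fun i => (hM i).2) 1).le
  | succ m ih =>
    calc pathMean b M (m + 1) (fun x => Real.exp (transSum φ x * l))
        = pathMean b M m fun y => Real.exp (transSum φ y * l) *
            ∑ j, M (y (Fin.last m)) j * Real.exp (φ (y (Fin.last m)) j * l) := by
          simp only [pathMean_succ, transSum_snoc, add_mul, Real.exp_add, Finset.mul_sum,
            mul_left_comm]
      _ ≤ pathMean b M m fun y => Real.exp (l ^ 2 / 2) * Real.exp (transSum φ y * l) := by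
          refine pathMean_mono hb.1 hM0 fun y => ?_
          rw [mul_comm]
          gcongr
          exact hoeffding_sum_mul_exp_le (hM _) (hφ _) (hφ_le _) l
      _ = Real.exp (l ^ 2 / 2) * pathMean b M m fun y => Real.exp (transSum φ y * l) :=
          pathMean_const_mul _ _
      _ ≤ Real.exp (l ^ 2 / 2) * Real.exp (m * (l ^ 2 / 2)) := by gcongr
      _ = Real.exp ((m + 1 : ℕ) * (l ^ 2 / 2)) := by
          rw [← Real.exp_add]; push_cast; ring_nf

theorem azuma_hoeffding_transSum (hb : b ∈ stdSimplex ℝ α) (hM : ∀ i, M i ∈ stdSimplex ℝ α)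
    {φ : α → α → ℝ} (hφ : ∀ i, ∑ j, M i j * φ i j = 0) (hφ_le : ∀ i j, |φ i j| ≤ 1) {e : ℝ}
    (he : 0 ≤ e) :
    pathMean b M m (fun x => if e * m < |transSum φ x| then 1 else 0) ≤
      2 * Real.exp (-(e ^ 2 / 2 * m)) := by
  have markov (s : ℝ) : (if e * m < |s| then 1 else 0) ≤
      Real.exp (-(e * (e * m))) * (Real.exp (s * e) + Real.exp (s * -e)) := by
    split_ifs with h
    · calc (1 : ℝ) ≤ Real.exp (-(e * (e * m)) + |s * e|) := by
            rw [Real.one_le_exp_iff, abs_mul, abs_of_nonneg he]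
            nlinarith
        _ ≤ _ := by
            rw [Real.exp_add, mul_neg]
            gcongr
            exact Real.exp_abs_le _
    · positivity
  calc pathMean b M m (fun x => if e * m < |transSum φ x| then 1 else 0)
      ≤ pathMean b M m fun x => Real.exp (-(e * (e * m))) *
          (Real.exp (transSum φ x * e) + Real.exp (transSum φ x * -e)) :=
        pathMean_mono hb.1 (fun i => (hM i).1) fun x => markov _
    _ = Real.exp (-(e * (e * m))) * (pathMean b M m (fun x => Real.exp (transSum φ x * e)) +
          pathMean b M m fun x => Real.exp (transSum φ x * -e)) := by
        rw [pathMean_const_mul, pathMean_add]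
    _ ≤ Real.exp (-(e * (e * m))) *
          (Real.exp (m * (e ^ 2 / 2)) + Real.exp (m * ((-e) ^ 2 / 2))) := by
        gcongr <;> exact pathMean_exp_transSum_le hb hM hφ hφ_le _
    _ = 2 * Real.exp (-(e ^ 2 / 2 * m)) := by
        rw [neg_sq, ← two_mul, mul_left_comm, ← Real.exp_add]
        ring_nf

end Paths

section FDivergence

/-- A convex function on `(0, ∞)` with the second-order expansion
`f x = c (x - 1) + A / 2 (x - 1)² + o((x - 1)²)` at `1`, where `0 < A`: the regularity under which
the `f`-divergence is asymptotically `A / 2` times the `χ²`-divergence. -/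
structure HasConvexExpansion (f : ℝ → ℝ) (c A : ℝ) : Prop where
  convexOn : ConvexOn ℝ (Ioi 0) f
  pos : 0 < A
  isLittleO : (fun x => f x - c * (x - 1) - A / 2 * (x - 1) ^ 2) =o[𝓝 1] fun x => (x - 1) ^ 2

theorem IsOrdinary.deriv_two_pos {f : ℝ → ℝ} (hf : IsOrdinary f) : 0 < iteratedDeriv 2 f 1 := by
  refine lt_of_le_of_ne ?_ hf.deriv_two_ne.symm
  have hdiff : DifferentiableOn ℝ f (Ioi 0) := hf.contDiffOn.differentiableOn (by norm_num)
  have hmono : MonotoneOn (deriv f) (Ioi 0) := hf.convexOn.monotoneOn_deriv fun x hx =>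
    hdiff.differentiableAt (Ioi_mem_nhds hx)
  rw [iteratedDeriv_succ, iteratedDeriv_one,
    ← derivWithin_of_isOpen isOpen_Ioi (mem_Ioi.2 one_pos)]
  exact hmono.derivWithin_nonneg

theorem IsOrdinary.hasConvexExpansion {f : ℝ → ℝ} (hf : IsOrdinary f) :
    HasConvexExpansion f (deriv f 1) (iteratedDeriv 2 f 1) := by
  have hmem : (1 : ℝ) ∈ Ioi (0 : ℝ) := mem_Ioi.2 one_pos
  refine ⟨hf.convexOn, hf.deriv_two_pos, ?_⟩
  have htaylor := taylor_isLittleO (convex_Ioi 0) hmem (hf.contDiffOn.of_le (m := 2) (by norm_num))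
  rw [nhdsWithin_eq_nhds.2 (Ioi_mem_nhds one_pos)] at htaylor
  refine htaylor.congr_left fun x => ?_
  simp only [taylorWithinEval_succ, taylor_within_zero_eval, hf.map_one,
    iteratedDerivWithin_of_isOpen isOpen_Ioi hmem, iteratedDeriv_one, smul_eq_mul, zero_add,
    CharP.cast_eq_zero, Nat.factorial, Nat.cast_one, pow_one, mul_one, inv_one, one_mul,
    one_add_one_eq_two]
  ring

/-- The excess of `f` over the line of slope `c` through `(1, 0)`. -/
def tangentGap (f : ℝ → ℝ) (c x : ℝ) : ℝ := f x - c * (x - 1)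

variable {f : ℝ → ℝ} {c A η : ℝ}

theorem HasConvexExpansion.tangentGap_one (hf : HasConvexExpansion f c A) :
    tangentGap f c 1 = 0 := by
  have h := (hf.isLittleO.def one_pos).self_of_nhds
  simpa [tangentGap] using h

theorem HasConvexExpansion.convexOn_tangentGap (hf : HasConvexExpansion f c A) :
    ConvexOn ℝ (Ioi 0) (tangentGap f c) := by
  refine ⟨convex_Ioi 0, fun x hx y hy s t hs ht hst => ?_⟩
  have := hf.convexOn.2 hx hy hs ht hst
  obtain rfl : t = 1 - s := by linarith
  simp only [tangentGap, smul_eq_mul] at this ⊢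
  linarith

theorem HasConvexExpansion.exists_abs_tangentGap_sub_le (hf : HasConvexExpansion f c A)
    (hη : 0 < η) : ∃ r : ℝ, 0 < r ∧ r < 1 ∧ ∀ x : ℝ, |x - 1| ≤ r →
      |tangentGap f c x - A / 2 * (x - 1) ^ 2| ≤ η * (A / 2) * (x - 1) ^ 2 := by
  have hA := hf.pos
  have h := hf.isLittleO.def (show 0 < η * (A / 2) by positivity)
  obtain ⟨r, hr, h⟩ := Metric.nhds_basis_closedBall.eventually_iff.1 h
  refine ⟨min r (1 / 2), by positivity, (min_le_right _ _).trans_lt (by norm_num), fun x hx => ?_⟩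
  have := h (Metric.mem_closedBall.2 (hx.trans (min_le_left _ _)))
  rwa [Real.norm_eq_abs, Real.norm_eq_abs, abs_sq] at this

theorem mul_abs_sub_le_of_convexOn {s : Set ℝ} {g : ℝ → ℝ} (hg : ConvexOn ℝ s g) {a r κ x : ℝ}
    (ha : g a = 0) (has : a ∈ s) (hr : 0 < r) (hright : a + r ∈ s) (hleft : a - r ∈ s)
    (hκ_right : κ * r ≤ g (a + r)) (hκ_left : κ * r ≤ g (a - r)) (hx : x ∈ s)
    (hxr : r ≤ |x - a|) : κ * |x - a| ≤ g x := by
  rcases le_abs.1 hxr with h | h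
  · have hmono := hg.secant_mono has hright hx (by linarith) (by linarith)
      (show a + r ≤ x by linarith)
    rw [ha, sub_zero, sub_zero, add_sub_cancel_left, div_le_div_iff₀ hr (by linarith)] at hmono
    rw [abs_of_nonneg (by linarith)]
    nlinarith
  · have hmono := hg.secant_mono has hx hleft (by linarith) (by linarith)
      (show x ≤ a - r by linarith)
    rw [ha, sub_zero, sub_zero, sub_sub_cancel_left, ← neg_sub a x, ← neg_div_neg_eq, neg_neg,
      ← neg_div_neg_eq (g _), neg_neg, div_le_div_iff₀ (by linarith) hr] at hmono
    rw [abs_of_nonpos (by linarith)]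
    nlinarith

theorem fDivTerm_of_pos (c : ℝ) {p q : ℝ} (hp : 0 < p) (hq : 0 < q) :
    fDivTerm f p q = ((c * (p - q) + q * tangentGap f c (p / q) : ℝ) : EReal) := by
  rw [fDivTerm, if_neg hq.ne', if_neg hp.ne', tangentGap]
  congr 1
  field_simp
  ring

theorem le_fDivTerm_zero {p κ r : ℝ} (hp : 0 < p)
    (h : ∀ x : ℝ, 0 < x → r ≤ |x - 1| → κ * |x - 1| ≤ tangentGap f c x) :
    ((c * p + κ * p : ℝ) : EReal) ≤ fDivTerm f p 0 := by
  rw [fDivTerm, if_pos rfl, ← add_mul, mul_comm, EReal.coe_mul]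
  refine mul_le_mul_of_nonneg_left ?_ (EReal.coe_nonneg.2 hp.le)
  have hlim : Tendsto (fun x : ℝ => (c + κ) * (1 - x⁻¹)) atTop (𝓝 (c + κ)) := by
    simpa using (tendsto_inv_atTop_zero.const_sub 1).const_mul (c + κ)
  rw [← (EReal.tendsto_coe.2 hlim).limsup_eq]
  refine limsup_le_limsup ?_
  filter_upwards [eventually_ge_atTop (1 + |r|)] with x hx
  have hx1 : 1 ≤ x := by linarith [abs_nonneg r]
  have hgap := h x (by linarith) (by rw [abs_of_nonneg (by linarith)]; linarith [le_abs_self r])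
  rw [abs_of_nonneg (by linarith), tangentGap] at hgap
  rw [EReal.coe_le_coe_iff, le_div_iff₀ (by linarith)]
  calc (c + κ) * (1 - x⁻¹) * x = c * (x - 1) + κ * (x - 1) := by field_simp
    _ ≤ f x := by linarith

/-- A lower bound for a term of an `f`-divergence, quadratic with coefficient `a` near the diagonal
and linear with slope `κ` away from it. -/
def divLower (a r κ p q : ℝ) : ℝ := if |p - q| ≤ r * q then a * ((p - q) ^ 2 / q) else κ * |p - q|

theorem divLower_nonneg {a r κ p q : ℝ} (ha : 0 ≤ a) (hκ : 0 ≤ κ) (hq : 0 ≤ q) :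
    0 ≤ divLower a r κ p q := by
  unfold divLower
  split_ifs <;> positivity

theorem le_fDivTerm_of_le_tangentGap {a r κ p q : ℝ}
    (hnear : ∀ x : ℝ, |x - 1| ≤ r → a * (x - 1) ^ 2 ≤ tangentGap f c x)
    (hfar : ∀ x : ℝ, 0 < x → r ≤ |x - 1| → κ * |x - 1| ≤ tangentGap f c x)
    (hp : 0 < p) (hq : 0 ≤ q) :
    ((c * (p - q) + divLower a r κ p q : ℝ) : EReal) ≤ fDivTerm f p q := by
  rcases hq.eq_or_lt with rfl | hq
  · rw [divLower, sub_zero, mul_zero, abs_of_pos hp, if_neg (not_le.2 hp)]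
    exact le_fDivTerm_zero hp hfar
  have hratio : p / q - 1 = (p - q) / q := by field_simp
  have habs : |p / q - 1| = |p - q| / q := by rw [hratio, abs_div, abs_of_pos hq]
  rw [fDivTerm_of_pos c hp hq, EReal.coe_le_coe_iff, divLower]
  gcongr
  split_ifs with h
  · calc a * ((p - q) ^ 2 / q) = q * (a * (p / q - 1) ^ 2) := by rw [hratio]; field_simp
      _ ≤ q * tangentGap f c (p / q) := by
        gcongr
        exact hnear _ (by rwa [habs, div_le_iff₀ hq])
  · calc κ * |p - q| = q * (κ * |p / q - 1|) := by rw [habs]; field_simp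
      _ ≤ q * tangentGap f c (p / q) := by
        gcongr
        refine hfar _ (by positivity) ?_
        rw [habs, le_div_iff₀ hq]
        exact (not_le.1 h).le

theorem HasConvexExpansion.exists_le_fDivTerm (hf : HasConvexExpansion f c A) (hη0 : 0 < η)
    (hη1 : η < 1) : ∃ r κ : ℝ, 0 < r ∧ 0 < κ ∧ ∀ p q : ℝ, 0 < p → 0 ≤ q →
      ((c * (p - q) + divLower ((1 - η) * (A / 2)) r κ p q : ℝ) : EReal) ≤ fDivTerm f p q := by
  have hA := hf.pos
  obtain ⟨r, hr0, hr1, hr⟩ := hf.exists_abs_tangentGap_sub_le hη0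
  have hnear : ∀ x : ℝ, |x - 1| ≤ r → (1 - η) * (A / 2) * (x - 1) ^ 2 ≤ tangentGap f c x :=
    fun x hx => by linarith [(abs_le.1 (hr x hx)).1]
  have : 0 < 1 - η := sub_pos.2 hη1
  refine ⟨r, (1 - η) * (A / 2) * r, hr0, by positivity, fun p q hp hq => ?_⟩
  refine le_fDivTerm_of_le_tangentGap hnear (fun x hx hxr => ?_) hp hq
  refine mul_abs_sub_le_of_convexOn hf.convexOn_tangentGap hf.tangentGap_one
    (mem_Ioi.2 one_pos) hr0
    (mem_Ioi.2 (by linarith)) (mem_Ioi.2 (by linarith)) ?_ ?_ hx hxr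
  · have := hnear (1 + r) (by rw [add_sub_cancel_left, abs_of_pos hr0])
    linarith
  · have := hnear (1 - r) (by rw [sub_sub_cancel_left, abs_neg, abs_of_pos hr0])
    linarith

theorem coe_sum_eReal {ι : Type*} (s : Finset ι) (g : ι → ℝ) :
    ((∑ i ∈ s, g i : ℝ) : EReal) = ∑ i ∈ s, (g i : EReal) :=
  map_sum (⟨⟨Real.toEReal, EReal.coe_zero⟩, EReal.coe_add⟩ : ℝ →+ EReal) g s

variable {k : ℕ} {p q : Fin k → ℝ}

theorem sum_le_fDiv (hpq : ∑ i, p i = ∑ i, q i) (X : Fin k → ℝ)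
    (h : ∀ i, ((c * (p i - q i) + X i : ℝ) : EReal) ≤ fDivTerm f (p i) (q i)) :
    ((∑ i, X i : ℝ) : EReal) ≤ fDiv f p q := by
  have hsum : ∑ i, X i = ∑ i, (c * (p i - q i) + X i) := by
    rw [Finset.sum_add_distrib, ← Finset.mul_sum, Finset.sum_sub_distrib, hpq, sub_self, mul_zero,
      zero_add]
  rw [hsum, coe_sum_eReal]
  exact Finset.sum_le_sum fun i _ => h i

theorem HasConvexExpansion.fDiv_nonneg (hf : HasConvexExpansion f c A)
    (hpq : ∑ i, p i = ∑ i, q i) (hp : ∀ i, 0 < p i) (hq : ∀ i, 0 ≤ q i) : 0 ≤ fDiv f p q := by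
  have hA := hf.pos
  obtain ⟨r, κ, -, hκ, h⟩ := hf.exists_le_fDivTerm (η := 1 / 2) (by norm_num) (by norm_num)
  refine le_trans ?_ (sum_le_fDiv hpq _ fun i => h (p i) (q i) (hp i) (hq i))
  exact EReal.coe_nonneg.2 <| Finset.sum_nonneg fun i _ =>
    divLower_nonneg (by positivity) hκ.le (hq i)

theorem le_divLower_of_near {a r κ β p q ζ : ℝ} (ha : 0 ≤ a) (hr : 0 < r) (hζ0 : 0 ≤ ζ)
    (hζr : ζ ≤ r / 4) (hζ1 : ζ ≤ 1 / 2) (hβ : 0 < β) (hp : |p - β| ≤ ζ * β)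
    (hq : |q - β| ≤ ζ * β) : (1 - ζ) * a * ((p - q) ^ 2 / β) ≤ divLower a r κ p q := by
  have hp := abs_le.1 hp
  have hq := abs_le.1 hq
  have hq_half : β / 2 ≤ q := by nlinarith
  have hq0 : 0 < q := by linarith
  have hpq : |p - q| ≤ r * q := by
    have : r * (β / 2) ≤ r * q := by gcongr
    have : ζ * β ≤ r / 4 * β := by gcongr
    exact abs_le.2 ⟨by linarith, by linarith⟩
  rw [divLower, if_pos hpq, mul_comm (1 - ζ), mul_assoc]
  gcongr
  rw [mul_div_assoc', div_le_div_iff₀ hβ hq0]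
  have : (1 - ζ) * q ≤ β := by nlinarith
  nlinarith [sq_nonneg (p - q)]

theorem min_le_divLower {a r κ e p q : ℝ} (ha : 0 ≤ a) (hκ : 0 ≤ κ) (he : 0 < e)
    (hq0 : 0 ≤ q) (hq1 : q ≤ 1) (hpq : e ≤ |p - q|) :
    min (κ * e) (a * e ^ 2) ≤ divLower a r κ p q := by
  unfold divLower
  split_ifs with h
  · have hsq : e ^ 2 ≤ (p - q) ^ 2 := by rw [← sq_abs (p - q)]; gcongr
    have hq : 0 < q := hq0.lt_of_ne' fun h0 => by rw [h0, mul_zero, ← h0] at h; linarith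
    refine (min_le_right _ _).trans (mul_le_mul_of_nonneg_left ?_ ha)
    rw [le_div_iff₀ hq]
    nlinarith [sq_nonneg e]
  · exact (min_le_left _ _).trans (mul_le_mul_of_nonneg_left hpq hκ)

theorem le_fDiv_of_near {a r κ ζ : ℝ} {b : Fin k → ℝ}
    (hterm : ∀ p q : ℝ, 0 < p → 0 ≤ q →
      ((c * (p - q) + divLower a r κ p q : ℝ) : EReal) ≤ fDivTerm f p q)
    (ha : 0 ≤ a) (hr : 0 < r) (hζ0 : 0 ≤ ζ) (hζr : ζ ≤ r / 4) (hζ1 : ζ ≤ 1 / 2)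
    (hb : ∀ j, 0 < b j) (hpq : ∑ j, p j = ∑ j, q j) (hp : ∀ j, 0 < p j) (hq : ∀ j, 0 ≤ q j)
    (hpb : ∀ j, |p j - b j| ≤ ζ * b j) (hqb : ∀ j, |q j - b j| ≤ ζ * b j) :
    (((1 - ζ) * a * ∑ j, (p j - q j) ^ 2 / b j : ℝ) : EReal) ≤ fDiv f p q := by
  refine le_trans ?_ (sum_le_fDiv hpq _ fun j => hterm (p j) (q j) (hp j) (hq j))
  rw [EReal.coe_le_coe_iff, Finset.mul_sum]
  exact Finset.sum_le_sum fun j _ => le_divLower_of_near ha hr hζ0 hζr hζ1 (hb j) (hpb j) (hqb j)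

theorem min_le_fDiv_of_far {a r κ e : ℝ}
    (hterm : ∀ p q : ℝ, 0 < p → 0 ≤ q →
      ((c * (p - q) + divLower a r κ p q : ℝ) : EReal) ≤ fDivTerm f p q)
    (ha : 0 ≤ a) (hκ : 0 ≤ κ) (he : 0 < e) (hp : ∀ j, 0 < p j) (hpq : ∑ j, p j = ∑ j, q j)
    (hq : q ∈ stdSimplex ℝ (Fin k)) {j : Fin k} (hj : e ≤ |p j - q j|) :
    ((min (κ * e) (a * e ^ 2) : ℝ) : EReal) ≤ fDiv f p q := by
  refine le_trans ?_ (sum_le_fDiv hpq _ fun j => hterm (p j) (q j) (hp j) (hq.1 j))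
  rw [EReal.coe_le_coe_iff]
  refine (min_le_divLower ha hκ he (hq.1 j) ?_ hj).trans
    (Finset.single_le_sum (fun i _ => divLower_nonneg ha hκ (hq.1 i)) (Finset.mem_univ j))
  exact (mem_Icc_of_mem_stdSimplex hq j).2

theorem exists_pos_sum_sq_div_le {ι : Type*} [Fintype ι] (b : ι → ℝ) (a : ℝ) {e K : ℝ}
    (he : 0 < e) (hK : 0 < K) : ∃ ε : ℝ, ε ≤ e ∧ a * ∑ j, ε ^ 2 / b j ≤ K ∧ 0 < ε := by
  have hlim : Tendsto (fun ε : ℝ => a * ∑ j, ε ^ 2 / b j) (𝓝[>] 0) (𝓝 0) := by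
    have hcont : Continuous fun ε : ℝ => a * ∑ j, ε ^ 2 / b j := by fun_prop
    simpa using (hcont.tendsto 0).mono_left nhdsWithin_le_nhds
  have hle : ∀ᶠ ε in 𝓝[>] (0 : ℝ), ε ≤ e := nhdsWithin_le_nhds (eventually_le_nhds he)
  exact (hle.and ((hlim.eventually_le_const hK).and self_mem_nhdsWithin)).exists

/-- Replacing every `q` far from `b` by `b` itself makes the quadratic lower bound global: the
linear part of `divLower` dominates the quadratic loss of `b` at all `p` close to `b`. -/
theorem HasConvexExpansion.exists_truncation (hf : HasConvexExpansion f c A) {b : Fin k → ℝ}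
    {β : ℝ} (hβ : 0 < β) (hb : ∀ j, β ≤ b j) (hη0 : 0 < η) (hη1 : η < 1) :
    ∃ ε : ℝ, 0 < ε ∧ ∃ T : (Fin k → ℝ) → Fin k → ℝ, ∀ p q : Fin k → ℝ,
      p ∈ stdSimplex ℝ (Fin k) → q ∈ stdSimplex ℝ (Fin k) → (∀ j, 0 < p j) →
      (∀ j, |p j - b j| ≤ ε) →
      (((1 - η) * (A / 2) * ∑ j, (p j - T q j) ^ 2 / b j : ℝ) : EReal) ≤ fDiv f p q := by
  classical
  have hA := hf.pos
  have hb0 : ∀ j, 0 < b j := fun j => hβ.trans_le (hb j)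
  have hη2 : 0 < 1 - η / 2 := by linarith
  obtain ⟨r, κ, hr, hκ, hterm⟩ := hf.exists_le_fDivTerm (η := η / 2) (by linarith) (by linarith)
  obtain ⟨ζ, hζ0, hζη, hζr, hζ1⟩ : ∃ ζ : ℝ, 0 < ζ ∧ ζ ≤ η / 2 ∧ ζ ≤ r / 4 ∧ ζ ≤ 1 / 2 :=
    ⟨min (η / 2) (min (r / 4) (1 / 2)), by positivity, by simp⟩
  have he : 0 < ζ * β / 2 := by positivity
  have hK : 0 < min (κ * (ζ * β / 2)) ((1 - η / 2) * (A / 2) * (ζ * β / 2) ^ 2) := by positivity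
  obtain ⟨ε, hεe, hεK, hε⟩ := exists_pos_sum_sq_div_le b ((1 - η) * (A / 2)) he hK
  have hζb : ∀ j, ζ * β ≤ ζ * b j := fun j => mul_le_mul_of_nonneg_left (hb j) hζ0.le
  refine ⟨ε, hε, fun q => if ∀ j, |q j - b j| ≤ ζ * b j then q else b, fun p q hp hq hp0 hpb => ?_⟩
  have hpq : ∑ j, p j = ∑ j, q j := hp.2.trans hq.2.symm
  beta_reduce
  split_ifs with hqb
  · refine le_trans ?_ (le_fDiv_of_near hterm (by positivity) hr hζ0.le hζr hζ1 hb0 hpq hp0 hq.1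
      (fun j => (hpb j).trans (by linarith [hζb j])) hqb)
    have hsum : 0 ≤ A / 2 * ∑ j, (p j - q j) ^ 2 / b j :=
      mul_nonneg (by positivity) (Finset.sum_nonneg fun j _ => div_nonneg (sq_nonneg _) (hb0 j).le)
    have hcoeff : 1 - η ≤ (1 - ζ) * (1 - η / 2) := by nlinarith
    rw [EReal.coe_le_coe_iff]
    linarith [mul_le_mul_of_nonneg_right hcoeff hsum]
  · push Not at hqb
    obtain ⟨j, hj⟩ := hqb
    have hfar : ζ * β / 2 ≤ |p j - q j| := by
      linarith [abs_sub_le (q j) (p j) (b j), abs_sub_comm (q j) (p j), hpb j, hζb j]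
    refine le_trans ?_ (min_le_fDiv_of_far hterm (by positivity) hκ.le he hp0 hpq hq hfar)
    refine EReal.coe_le_coe (le_trans ?_ hεK)
    have hcoeff : 0 ≤ (1 - η) * (A / 2) := mul_nonneg (sub_nonneg.2 hη1.le) (half_pos hA).le
    refine mul_le_mul_of_nonneg_left (Finset.sum_le_sum fun j _ => ?_) hcoeff
    exact div_le_div_of_nonneg_right (sq_le_sq' (neg_le_of_abs_le (hpb j)) (le_of_abs_le (hpb j)))
      (hb0 j).le

theorem fDiv_of_pos (c : ℝ) (hp : ∀ j, 0 < p j) (hq : ∀ j, 0 < q j)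
    (hpq : ∑ j, p j = ∑ j, q j) :
    fDiv f p q = ((∑ j, q j * tangentGap f c (p j / q j) : ℝ) : EReal) := by
  rw [fDiv, Finset.sum_congr rfl fun j _ => fDivTerm_of_pos c (hp j) (hq j), ← coe_sum_eReal,
    Finset.sum_add_distrib, ← Finset.mul_sum, Finset.sum_sub_distrib, hpq, sub_self, mul_zero,
    zero_add]

theorem HasConvexExpansion.exists_fDiv_le_const (hf : HasConvexExpansion f c A) (k : ℕ) {δ : ℝ}
    (hδ : 0 < δ) : ∃ C : ℝ, 0 ≤ C ∧ ∀ p q : Fin k → ℝ, p ∈ stdSimplex ℝ (Fin k) →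
      q ∈ stdSimplex ℝ (Fin k) → (∀ j, δ ≤ p j) → (∀ j, δ ≤ q j) → fDiv f p q ≤ (C : EReal) := by
  have hcont : ContinuousOn (tangentGap f c) (Icc δ (1 / δ)) :=
    (hf.convexOn_tangentGap.continuousOn isOpen_Ioi).mono fun x hx => hδ.trans_le hx.1
  obtain ⟨C, hC⟩ := isCompact_Icc.exists_bound_of_continuousOn hcont
  refine ⟨|C|, abs_nonneg C, fun p q hp hq hpδ hqδ => ?_⟩
  have hp0 : ∀ j, 0 < p j := fun j => hδ.trans_le (hpδ j)
  have hq0 : ∀ j, 0 < q j := fun j => hδ.trans_le (hqδ j)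
  rw [fDiv_of_pos c hp0 hq0 (hp.2.trans hq.2.symm), EReal.coe_le_coe_iff]
  calc ∑ j, q j * tangentGap f c (p j / q j) ≤ ∑ j, q j * |C| := by
        refine Finset.sum_le_sum fun j _ => mul_le_mul_of_nonneg_left ?_ (hq0 j).le
        have hpj := (mem_Icc_of_mem_stdSimplex hp j).2
        have hqj := (mem_Icc_of_mem_stdSimplex hq j).2
        refine (le_abs_self _).trans ((hC _ ⟨?_, ?_⟩).trans (le_abs_self C))
        · rw [le_div_iff₀ (hq0 j)]
          nlinarith [hpδ j]
        · exact div_le_div₀ zero_le_one hpj hδ (hqδ j)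
    _ = |C| := by rw [← Finset.sum_mul, hq.2, one_mul]

theorem mul_tangentGap_div_le {r ζ p q : ℝ} (hA : 0 ≤ A) (hζ : 0 ≤ ζ)
    (hr : ∀ x : ℝ, |x - 1| ≤ r →
      |tangentGap f c x - A / 2 * (x - 1) ^ 2| ≤ ζ * (A / 2) * (x - 1) ^ 2)
    (hp : 0 < p) (hq : 0 < q) (hpq : |p - q| ≤ min r ζ * q) :
    q * tangentGap f c (p / q) ≤ (1 + ζ) ^ 2 * (A / 2) * ((q - p) ^ 2 / p) := by
  have hratio : p / q - 1 = (p - q) / q := by field_simp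
  have hclose : |p / q - 1| ≤ min r ζ := by
    rwa [hratio, abs_div, abs_of_pos hq, div_le_iff₀ hq]
  have hgap := (abs_le.1 (hr _ (hclose.trans (min_le_left _ _)))).2
  have hp_le : p ≤ (1 + ζ) * q := by
    have := mul_le_mul_of_nonneg_right (min_le_right r ζ) hq.le
    linarith [(abs_le.1 hpq).2]
  calc q * tangentGap f c (p / q) ≤ q * ((1 + ζ) * (A / 2) * (p / q - 1) ^ 2) := by
        gcongr
        linarith
    _ = (1 + ζ) * (A / 2) * ((q - p) ^ 2 / q) := by
        rw [hratio]
        field_simp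
        ring
    _ ≤ (1 + ζ) * (A / 2) * ((1 + ζ) * ((q - p) ^ 2 / p)) := by
        gcongr (1 + ζ) * (A / 2) * ?_
        rw [mul_div_assoc', div_le_div_iff₀ hq hp]
        nlinarith [sq_nonneg (q - p)]
    _ = (1 + ζ) ^ 2 * (A / 2) * ((q - p) ^ 2 / p) := by ring

theorem HasConvexExpansion.exists_fDiv_le_quadratic (hf : HasConvexExpansion f c A) (k : ℕ) {δ : ℝ}
    (hδ : 0 < δ) (hη : 0 < η) : ∃ s : ℝ, 0 < s ∧ ∀ p q : Fin k → ℝ, ∑ j, p j = ∑ j, q j →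
      (∀ j, δ ≤ p j) → (∀ j, δ ≤ q j) → (∀ j, |q j - p j| ≤ s) →
      fDiv f p q ≤ (((1 + η) * (A / 2) * ∑ j, (q j - p j) ^ 2 / p j : ℝ) : EReal) := by
  have hA := hf.pos
  obtain ⟨ζ, hζ0, hζ1, hζη⟩ : ∃ ζ : ℝ, 0 < ζ ∧ ζ ≤ 1 ∧ ζ ≤ η / 3 :=
    ⟨min 1 (η / 3), by positivity, by simp⟩
  obtain ⟨r, hr0, -, hr⟩ := hf.exists_abs_tangentGap_sub_le hζ0
  refine ⟨min r ζ * δ, by positivity, fun p q hpq hpδ hqδ hs => ?_⟩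
  have hp0 : ∀ j, 0 < p j := fun j => hδ.trans_le (hpδ j)
  have hq0 : ∀ j, 0 < q j := fun j => hδ.trans_le (hqδ j)
  rw [fDiv_of_pos c hp0 hq0 hpq, EReal.coe_le_coe_iff, Finset.mul_sum]
  refine Finset.sum_le_sum fun j _ => ?_
  have hclose : |p j - q j| ≤ min r ζ * q j := by
    rw [abs_sub_comm]
    exact (hs j).trans (mul_le_mul_of_nonneg_left (hqδ j) (by positivity))
  refine (mul_tangentGap_div_le hA.le hζ0.le hr (hp0 j) (hq0 j) hclose).trans ?_
  have := (hp0 j).le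
  gcongr
  nlinarith

end FDivergence

section StateRisk

variable {k m : ℕ}

/-- The transition probabilities of a chain, as a function. -/
def MarkovModel.prob (P : MarkovModel k) (i j : Fin k) : ℝ := P.trans i j

theorem MarkovModel.prob_mem_stdSimplex (P : MarkovModel k) (i : Fin k) :
    P.prob i ∈ stdSimplex ℝ (Fin k) :=
  ⟨P.trans_mem.1 i, (Matrix.mem_rowStochastic_iff_sum.1 P.trans_mem).2 i⟩

theorem MarkovModel.sum_stat_mul_prob (P : MarkovModel k) (j : Fin k) :
    ∑ i, P.stat i * P.prob i j = P.stat j :=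
  congrFun P.stat_eq j

theorem rowStochastic_row_mem_stdSimplex (Q : Matrix.rowStochastic ℝ (Fin k)) (i : Fin k) :
    Q.1 i ∈ stdSimplex ℝ (Fin k) :=
  ⟨Q.2.1 i, (Matrix.mem_rowStochastic_iff_sum.1 Q.2).2 i⟩

theorem coe_pathMean (b : Fin k → ℝ) (M : Fin k → Fin k → ℝ) (F : (Fin (m + 1) → Fin k) → ℝ) :
    (pathMean b M m F : EReal) = ∑ x, (pathWeight b M m x : EReal) * (F x : EReal) := by
  simp only [pathMean, coe_sum_eReal, EReal.coe_mul]

variable {L : (Fin k → ℝ) → (Fin k → ℝ) → EReal} {P : MarkovModel k} {E : Estimator (m + 1) k}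
  {i : Fin k} {B : (Fin (m + 1) → Fin k) → ℝ}

theorem stateRisk_le_pathMean (h : ∀ x, L (P.prob i) ((E x).1 i) ≤ (B x : EReal)) :
    stateRisk L P E i ≤ (pathMean P.init P.prob m B : EReal) := by
  rw [coe_pathMean]
  exact Finset.sum_le_sum fun x _ => mul_le_mul_of_nonneg_left (h x)
    (EReal.coe_nonneg.2 (pathWeight_nonneg P.init_mem.1 P.trans_mem.1 x))

theorem pathMean_le_stateRisk (h : ∀ x, (B x : EReal) ≤ L (P.prob i) ((E x).1 i)) :
    (pathMean P.init P.prob m B : EReal) ≤ stateRisk L P E i := by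
  rw [coe_pathMean]
  exact Finset.sum_le_sum fun x _ => mul_le_mul_of_nonneg_left (h x)
    (EReal.coe_nonneg.2 (pathWeight_nonneg P.init_mem.1 P.trans_mem.1 x))

end StateRisk

section Contraction

variable {α : Type*} [Fintype α] {M : α → α → ℝ} {δ e : ℝ}

/-- Contraction: subtracting `δ` from every entry of `M` does not change its action on vectors of
sum `0`, and leaves row sums `1 - card α * δ`. -/
theorem mul_sum_abs_le_of_sum_eq_zero [Nonempty α] (hMδ : ∀ i j, δ ≤ M i j)
    (hM : ∀ i, ∑ j, M i j = 1) {w : α → ℝ} (hw : ∑ i, w i = 0)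
    (he : ∀ j, |w j - ∑ i, w i * M i j| ≤ e) :
    δ * ∑ j, |w j| ≤ e := by
  have hcontract : ∀ j, |w j| ≤ e + ∑ i, |w i| * (M i j - δ) := by
    intro j
    have hshift : ∑ i, w i * M i j = ∑ i, w i * (M i j - δ) := by
      simp only [mul_sub, Finset.sum_sub_distrib, ← Finset.sum_mul, hw, zero_mul, sub_zero]
    have habs : |∑ i, w i * (M i j - δ)| ≤ ∑ i, |w i| * (M i j - δ) := by
      refine (Finset.abs_sum_le_sum_abs _ _).trans (Finset.sum_le_sum fun i _ => ?_)
      rw [abs_mul, abs_of_nonneg (sub_nonneg.2 (hMδ i j))]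
    have hdiff := he j
    rw [hshift] at hdiff
    linarith [abs_sub_abs_le_abs_sub (w j) (∑ i, w i * (M i j - δ))]
  have hrow : ∑ j, ∑ i, |w i| * (M i j - δ) = (1 - Fintype.card α * δ) * ∑ i, |w i| := by
    rw [Finset.sum_comm, Finset.mul_sum]
    refine Finset.sum_congr rfl fun i _ => ?_
    rw [← Finset.mul_sum, Finset.sum_sub_distrib, hM, Finset.sum_const, Finset.card_univ,
      nsmul_eq_mul, mul_comm]
  have hsum := Finset.sum_le_sum fun j (_ : j ∈ Finset.univ) => hcontract j
  rw [Finset.sum_add_distrib, hrow, Finset.sum_const, Finset.card_univ, nsmul_eq_mul] at hsum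
  have hcard : (0 : ℝ) < Fintype.card α := by exact_mod_cast Fintype.card_pos
  exact le_of_mul_le_mul_left (by linarith) hcard

theorem abs_sub_stationary_le (hδ : 0 < δ) (hMδ : ∀ i j, δ ≤ M i j) (hM : ∀ i, ∑ j, M i j = 1)
    {π v : α → ℝ} {s : ℝ} (hπ : ∑ i, π i = 1) (hπM : ∀ j, ∑ i, π i * M i j = π j)
    (hv : ∑ i, v i = s) (he : ∀ j, |v j - ∑ i, v i * M i j| ≤ e) (j : α) :
    |v j - s * π j| ≤ e / δ := by
  have : Nonempty α := ⟨j⟩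
  have hsum : ∑ i, (v i - s * π i) = 0 := by
    rw [Finset.sum_sub_distrib, ← Finset.mul_sum, hv, hπ, mul_one, sub_self]
  have hdiff : ∀ j, |v j - s * π j - ∑ i, (v i - s * π i) * M i j| ≤ e := fun j => by
    simp only [sub_mul, mul_assoc, Finset.sum_sub_distrib, ← Finset.mul_sum, hπM,
      sub_sub_sub_cancel_right, he]
  rw [le_div_iff₀' hδ]
  refine (mul_le_mul_of_nonneg_left ?_ hδ.le).trans
    (mul_sum_abs_le_of_sum_eq_zero hMδ hM hsum hdiff)
  exact Finset.single_le_sum (f := fun j => |v j - s * π j|) (fun _ _ => abs_nonneg _)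
    (Finset.mem_univ j)

end Contraction

section Counts

variable {α : Type*} [DecidableEq α] {m : ℕ}

/-- The number of transitions of a path that start in `i`. -/
def visitCount (i : α) (x : Fin (m + 1) → α) : ℝ :=
  transSum (fun i' _ => if i' = i then 1 else 0) x

/-- The number of transitions of a path from `i` to `j`. -/
def transCount (i j : α) (x : Fin (m + 1) → α) : ℝ :=
  transSum (fun i' j' => if i' = i then (if j' = j then 1 else 0) else 0) x

/-- The deviation of one transition into `j` from its conditional mean, on the state `i`. -/
def transDev (M : α → α → ℝ) (i j : α) (i' j' : α) : ℝ :=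
  if i' = i then (if j' = j then 1 else 0) - M i j else 0

theorem transSum_transDev (M : α → α → ℝ) (i j : α) (x : Fin (m + 1) → α) :
    transSum (transDev M i j) x = transCount i j x - M i j * visitCount i x := by
  unfold transCount visitCount transSum
  rw [Finset.mul_sum, ← Finset.sum_sub_distrib]
  refine Finset.sum_congr rfl fun t _ => ?_
  beta_reduce
  unfold transDev
  split_ifs <;> ring

variable [Fintype α]

theorem sum_transCount (i : α) (x : Fin (m + 1) → α) :
    ∑ j, transCount i j x = visitCount i x := by
  unfold transCount visitCount transSum
  rw [Finset.sum_comm]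
  refine Finset.sum_congr rfl fun t _ => ?_
  beta_reduce
  split_ifs <;> simp

theorem sum_visitCount (x : Fin (m + 1) → α) : ∑ i, visitCount i x = m := by
  unfold visitCount transSum
  rw [Finset.sum_comm]
  simp

/-- The two counts differ only at the two ends of the path. -/
theorem abs_visitCount_sub_sum_transCount_le (j : α) (x : Fin (m + 1) → α) :
    |visitCount j x - ∑ i, transCount i j x| ≤ 1 := by
  have harrivals : ∑ i, transCount i j x = ∑ t : Fin m, if x t.succ = j then (1 : ℝ) else 0 := by
    unfold transCount transSum
    rw [Finset.sum_comm]
    exact Finset.sum_congr rfl fun t _ => by simp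
  have hcast := Fin.sum_univ_castSucc fun t : Fin (m + 1) => if x t = j then (1 : ℝ) else 0
  have hsucc := Fin.sum_univ_succ fun t : Fin (m + 1) => if x t = j then (1 : ℝ) else 0
  have hends : visitCount j x - ∑ i, transCount i j x =
      (if x 0 = j then 1 else 0) - if x (Fin.last m) = j then 1 else 0 := by
    rw [harrivals, visitCount, transSum]
    linarith
  rw [hends]
  split_ifs <;> norm_num

variable {b π : α → ℝ} {M : α → α → ℝ} {δ e : ℝ}

theorem sum_mul_transDev (hM : ∀ i, ∑ j, M i j = 1) (i j i' : α) :
    ∑ j', M i' j' * transDev M i j i' j' = 0 := by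
  unfold transDev
  split_ifs with h
  · subst h
    simp [mul_sub, Finset.sum_sub_distrib, ← Finset.sum_mul, hM]
  · simp

theorem sum_mul_transDev_sq (hM : ∀ i, ∑ j, M i j = 1) (i j i' : α) :
    ∑ j', M i' j' * transDev M i j i' j' ^ 2 =
      M i j * (1 - M i j) * if i' = i then 1 else 0 := by
  unfold transDev
  split_ifs with h
  · subst h
    have hexpand : ∀ j', M i' j' * ((if j' = j then 1 else 0) - M i' j) ^ 2 =
        (if j' = j then M i' j' else 0) * (1 - 2 * M i' j) + M i' j' * M i' j ^ 2 := by
      intro j'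
      split_ifs <;> ring
    simp only [hexpand, Finset.sum_add_distrib, ← Finset.sum_mul, hM, Finset.sum_ite_eq',
      Finset.mem_univ, if_true]
    ring
  · simp

theorem abs_transDev_le (hM : ∀ i, M i ∈ stdSimplex ℝ α) (i j i' j' : α) :
    |transDev M i j i' j'| ≤ 1 := by
  obtain ⟨h0, h1⟩ := mem_Icc_of_mem_stdSimplex (hM i) j
  unfold transDev
  split_ifs <;> rw [abs_le] <;> constructor <;> linarith

theorem abs_visitCount_sub_le (hδ : 0 < δ) (hMδ : ∀ i j, δ ≤ M i j) (hM : ∀ i, ∑ j, M i j = 1)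
    (hπ : ∑ i, π i = 1) (hπM : ∀ j, ∑ i, π i * M i j = π j) {x : Fin (m + 1) → α}
    (he : ∀ i j, |transSum (transDev M i j) x| ≤ e) (i : α) :
    |visitCount i x - m * π i| ≤ (1 + Fintype.card α * e) / δ := by
  refine abs_sub_stationary_le (v := fun i => visitCount i x) hδ hMδ hM hπ hπM (sum_visitCount x)
    (fun j => ?_) i
  have hdev : |∑ i, transCount i j x - ∑ i, visitCount i x * M i j| ≤ Fintype.card α * e := by
    simp only [transSum_transDev] at he
    simp only [mul_comm (visitCount _ x), ← Finset.sum_sub_distrib]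
    refine (Finset.abs_sum_le_sum_abs _ _).trans ((Finset.sum_le_sum fun i _ => he i j).trans ?_)
    rw [Finset.sum_const, Finset.card_univ, nsmul_eq_mul]
  exact (abs_sub_le _ _ _).trans (add_le_add (abs_visitCount_sub_sum_transCount_le j x) hdev)

theorem pathMean_transCount (hM : ∀ i, ∑ j, M i j = 1) (i j : α) :
    pathMean b M m (transCount i j) = pathMean b M m (visitCount i) * M i j := by
  have hzero := pathMean_transSum_eq_zero (b := b) (m := m) _ hM (sum_mul_transDev hM i j)
  rw [funext (transSum_transDev M i j), pathMean_sub, pathMean_const_mul] at hzero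
  linarith

theorem abs_pathMean_visitCount_sub_le (hb : b ∈ stdSimplex ℝ α) (hM : ∀ i, M i ∈ stdSimplex ℝ α)
    (hδ : 0 < δ) (hMδ : ∀ i j, δ ≤ M i j) (hπ : ∑ i, π i = 1)
    (hπM : ∀ j, ∑ i, π i * M i j = π j) (i : α) :
    |pathMean b M m (visitCount i) - m * π i| ≤ 1 / δ := by
  have hsum : ∑ i, pathMean b M m (visitCount i) = m := by
    rw [← pathMean_sum]
    simp only [sum_visitCount]
    exact pathMean_const hb.2 (fun i => (hM i).2) m
  refine abs_sub_stationary_le hδ hMδ (fun i => (hM i).2) hπ hπM hsum (fun j => ?_) i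
  have hbound : ∀ x : Fin (m + 1) → α, -1 ≤ visitCount j x - ∑ i, transCount i j x ∧
      visitCount j x - ∑ i, transCount i j x ≤ 1 :=
    fun x => abs_le.1 (abs_visitCount_sub_sum_transCount_le j x)
  simp only [← pathMean_transCount fun i => (hM i).2]
  rw [← pathMean_sum, ← pathMean_sub, abs_le]
  constructor
  · exact (pathMean_const hb.2 (fun i => (hM i).2) (-1)).ge.trans
      (pathMean_mono hb.1 (fun i => (hM i).1) fun x => (hbound x).1)
  · exact (pathMean_mono hb.1 (fun i => (hM i).1) fun x => (hbound x).2).trans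
      (pathMean_const hb.2 (fun i => (hM i).2) 1).le

theorem pathMean_transDev_sq (hM : ∀ i, ∑ j, M i j = 1) (i j : α) :
    pathMean b M m (fun x => transSum (transDev M i j) x ^ 2) =
      M i j * (1 - M i j) * pathMean b M m (visitCount i) := by
  rw [pathMean_transSum_sq _ hM (sum_mul_transDev hM i j), ← pathMean_const_mul]
  congr 1
  funext x
  simp only [sum_mul_transDev_sq hM, visitCount, transSum, Finset.mul_sum]

/-- Each transition from `i` has conditional variance `M i j * (1 - M i j)` in direction `j`, and
`∑ j, (1 - M i j) = card α - 1`. -/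
theorem pathMean_sum_transDev_sq_div_le (hb : b ∈ stdSimplex ℝ α)
    (hM : ∀ i, M i ∈ stdSimplex ℝ α) (hδ : 0 < δ) (hMδ : ∀ i j, δ ≤ M i j) (hπ : ∑ i, π i = 1)
    (hπM : ∀ j, ∑ i, π i * M i j = π j) (i : α) :
    pathMean b M m (fun x => ∑ j, transSum (transDev M i j) x ^ 2 / M i j) ≤
      (Fintype.card α - 1) * (m * π i + 1 / δ) := by
  have hterm : ∀ j, pathMean b M m (fun x => transSum (transDev M i j) x ^ 2 / M i j) =
      (1 - M i j) * pathMean b M m (visitCount i) := fun j => by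
    have : M i j ≠ 0 := (hδ.trans_le (hMδ i j)).ne'
    simp only [div_eq_inv_mul]
    rw [pathMean_const_mul, pathMean_transDev_sq fun i => (hM i).2]
    field_simp
  rw [pathMean_sum]
  simp only [hterm]
  rw [← Finset.sum_mul, Finset.sum_sub_distrib, (hM i).2, Finset.sum_const, Finset.card_univ,
    nsmul_eq_mul, mul_one]
  have hcard : (1 : ℝ) ≤ Fintype.card α := by
    exact_mod_cast (Fintype.card_pos_iff.2 ⟨i⟩ : 0 < Fintype.card α)
  have hvisit := abs_le.1 (abs_pathMean_visitCount_sub_le (m := m) hb hM hδ hMδ hπ hπM i)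
  exact mul_le_mul_of_nonneg_left (by linarith [hvisit.2]) (by linarith)

end Counts

section Empirical

variable {α : Type*} [Fintype α] [DecidableEq α] {m : ℕ} {δ : ℝ} {x : Fin (m + 1) → α} {i : α}

open scoped Classical in
/-- The empirical transition probabilities out of `i`, replaced by the uniform distribution as soon
as one of them is below `δ / 2`. The truncation keeps the divergence from a row with entries at
least `δ` bounded. -/
def empiricalRow (δ : ℝ) (x : Fin (m + 1) → α) (i j : α) : ℝ :=
  if 0 < visitCount i x ∧ ∀ j, δ / 2 ≤ transCount i j x / visitCount i x then
    transCount i j x / visitCount i x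
  else 1 / Fintype.card α

theorem le_empiricalRow {p : α → ℝ} (hp : ∑ j, p j = 1) (hpδ : ∀ j, δ ≤ p j)
    (x : Fin (m + 1) → α) (i j : α) : δ / 2 ≤ empiricalRow δ x i j := by
  unfold empiricalRow
  split_ifs with h
  · exact h.2 j
  · have hcard : (0 : ℝ) < Fintype.card α := by exact_mod_cast Fintype.card_pos_iff.2 ⟨i⟩
    have hsum := Finset.card_nsmul_le_sum Finset.univ p δ fun j _ => hpδ j
    rw [hp, Finset.card_univ, nsmul_eq_mul] at hsum
    rw [le_div_iff₀' hcard]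
    linarith

theorem empiricalRow_mem_stdSimplex (hδ : 0 ≤ δ) (x : Fin (m + 1) → α) (i : α) :
    empiricalRow δ x i ∈ stdSimplex ℝ α := by
  constructor
  · intro j
    unfold empiricalRow
    split_ifs with h
    exacts [(div_nonneg hδ zero_le_two).trans (h.2 j), by positivity]
  · unfold empiricalRow
    split_ifs with h
    · rw [← Finset.sum_div, sum_transCount, div_self h.1.ne']
    · have : (Fintype.card α : ℝ) ≠ 0 := by exact_mod_cast (Fintype.card_pos_iff.2 ⟨i⟩).ne'
      simp [this]

theorem empiricalRow_sub_eq {M : α → α → ℝ} (hMδ : ∀ j, δ ≤ M i j) (hvisit : 0 < visitCount i x)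
    (hdev : ∀ j, |transSum (transDev M i j) x| ≤ δ / 2 * visitCount i x) (j : α) :
    empiricalRow δ x i j - M i j = transSum (transDev M i j) x / visitCount i x := by
  have hsub : ∀ j, transCount i j x / visitCount i x =
      M i j + transSum (transDev M i j) x / visitCount i x := fun j => by
    rw [transSum_transDev]
    field_simp
    ring
  have hge : ∀ j, δ / 2 ≤ transCount i j x / visitCount i x := fun j => by
    rw [hsub]
    have := neg_le_of_abs_le (hdev j)
    rw [← neg_mul, ← le_div_iff₀ hvisit] at this
    linarith [hMδ j]
  rw [empiricalRow, if_pos ⟨hvisit, hge⟩, hsub, add_sub_cancel_left]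

/-- The estimator whose rows are the truncated empirical transition probabilities. -/
def empiricalEstimator {k : ℕ} (hδ : 0 ≤ δ) : Estimator (m + 1) k := fun x =>
  ⟨Matrix.of (empiricalRow δ x), Matrix.mem_rowStochastic_iff_sum.2
    ⟨fun i => (empiricalRow_mem_stdSimplex hδ x i).1,
      fun i => (empiricalRow_mem_stdSimplex hδ x i).2⟩⟩

end Empirical

section UpperBound

variable {k m : ℕ} {δ ρ η c A : ℝ} {f : ℝ → ℝ}

theorem fDiv_empiricalRow_le {M : Fin k → Fin k → ℝ} {a s r v : ℝ}
    (hquad : ∀ p q : Fin k → ℝ, ∑ j, p j = ∑ j, q j → (∀ j, δ / 2 ≤ p j) → (∀ j, δ / 2 ≤ q j) →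
      (∀ j, |q j - p j| ≤ s) → fDiv f p q ≤ ((a * ∑ j, (q j - p j) ^ 2 / p j : ℝ) : EReal))
    (ha : 0 ≤ a) (hδ : 0 < δ) (hr : 0 ≤ r) (hrs : r ≤ s) (hrδ : r ≤ δ / 2)
    {x : Fin (m + 1) → Fin k} {i : Fin k} (hM : ∑ j, M i j = 1) (hMδ : ∀ j, δ ≤ M i j)
    (hv : 0 < v) (hvisit : v ≤ visitCount i x)
    (hdev : ∀ j, |transSum (transDev M i j) x| ≤ r * v) :
    fDiv f (M i) (empiricalRow δ x i) ≤
      ((a / v ^ 2 * ∑ j, transSum (transDev M i j) x ^ 2 / M i j : ℝ) : EReal) := by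
  have hvisit0 : 0 < visitCount i x := hv.trans_le hvisit
  have hdev_le : ∀ j, |transSum (transDev M i j) x| ≤ r * visitCount i x := fun j =>
    (hdev j).trans (mul_le_mul_of_nonneg_left hvisit hr)
  have herror := empiricalRow_sub_eq hMδ hvisit0 fun j =>
    (hdev_le j).trans (mul_le_mul_of_nonneg_right hrδ hvisit0.le)
  refine (hquad (M i) (empiricalRow δ x i) (hM.trans (empiricalRow_mem_stdSimplex hδ.le x i).2.symm)
    (fun j => (half_le_self hδ.le).trans (hMδ j)) (le_empiricalRow hM hMδ x i)
    fun j => ?_).trans ?_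
  · rw [herror, abs_div, abs_of_pos hvisit0]
    exact ((div_le_iff₀ hvisit0).2 (hdev_le j)).trans hrs
  · rw [EReal.coe_le_coe_iff, div_mul_eq_mul_div, mul_div_assoc, Finset.sum_div]
    refine mul_le_mul_of_nonneg_left (Finset.sum_le_sum fun j _ => ?_) ha
    have : 0 < M i j := hδ.trans_le (hMδ j)
    rw [herror, div_pow, div_right_comm]
    gcongr

theorem exists_deviation_scale {K r : ℝ} (hK : 0 < K) (hδ : 0 < δ) (hρ : 0 < ρ) (hη0 : 0 < η)
    (hη1 : η < 1) (hr : 0 < r) :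
    ∃ ε : ℝ, 0 < ε ∧ ∀ᶠ m : ℕ in atTop, ∀ t, ρ ≤ t →
      (1 + K * (ε * m)) / δ ≤ η * (m * t) ∧ ε * m ≤ r * ((1 - η) * (m * t)) := by
  have : 0 < 1 - η := sub_pos.2 hη1
  refine ⟨min (η * ρ * δ / (2 * K)) (r * ((1 - η) * ρ)), by positivity, ?_⟩
  set ε := min (η * ρ * δ / (2 * K)) (r * ((1 - η) * ρ))
  have hεK : ε * (2 * K) ≤ η * ρ * δ := (le_div_iff₀ (by positivity)).1 (min_le_left _ _)
  have hεr : ε ≤ r * ((1 - η) * ρ) := min_le_right _ _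
  filter_upwards [tendsto_natCast_atTop_atTop.eventually_ge_atTop (2 / (η * ρ * δ))] with m hm t ht
  rw [div_le_iff₀ (by positivity)] at hm
  constructor
  · calc (1 + K * (ε * m)) / δ ≤ (m * (η * ρ * δ) / 2 + m * (η * ρ * δ) / 2) / δ := by
          gcongr ?_ / δ
          nlinarith [mul_le_mul_of_nonneg_left hεK m.cast_nonneg (α := ℝ)]
      _ = η * (m * ρ) := by field_simp; ring
      _ ≤ η * (m * t) := by gcongr
  · calc ε * m ≤ r * ((1 - η) * ρ) * m := by gcongr
      _ = r * ((1 - η) * (m * ρ)) := by ring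
      _ ≤ r * ((1 - η) * (m * t)) := by gcongr

theorem pathMean_sum_deviation_le {α : Type*} [Fintype α] [DecidableEq α] {b : α → ℝ}
    {M : α → α → ℝ} (hb : b ∈ stdSimplex ℝ α) (hM : ∀ i, M i ∈ stdSimplex ℝ α) {ε : ℝ}
    (hε : 0 ≤ ε) :
    pathMean b M m (fun x => ∑ ij : α × α,
        if ε * m < |transSum (transDev M ij.1 ij.2) x| then 1 else 0) ≤
      2 * Fintype.card α ^ 2 * Real.exp (-(ε ^ 2 / 2 * m)) := by
  rw [pathMean_sum]
  refine (Finset.sum_le_card_nsmul _ _ _ fun ij _ => azuma_hoeffding_transSum hb hM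
    (sum_mul_transDev (fun i => (hM i).2) ij.1 ij.2) (abs_transDev_le hM ij.1 ij.2) hε).trans_eq ?_
  rw [Finset.card_univ, Fintype.card_prod, nsmul_eq_mul]
  push_cast
  ring

/-- Either all transition deviations are small and the quadratic bound applies, or one of the
indicators in the second sum is `1` and the constant bound applies. -/
theorem fDiv_empiricalRow_le_add_sum_deviation {M : Fin k → Fin k → ℝ} {a C s r ε : ℝ}
    {π : Fin k → ℝ}
    (hquad : ∀ p q : Fin k → ℝ, ∑ j, p j = ∑ j, q j → (∀ j, δ / 2 ≤ p j) → (∀ j, δ / 2 ≤ q j) →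
      (∀ j, |q j - p j| ≤ s) → fDiv f p q ≤ ((a * ∑ j, (q j - p j) ^ 2 / p j : ℝ) : EReal))
    (hconst : ∀ p q : Fin k → ℝ, p ∈ stdSimplex ℝ (Fin k) → q ∈ stdSimplex ℝ (Fin k) →
      (∀ j, δ / 2 ≤ p j) → (∀ j, δ / 2 ≤ q j) → fDiv f p q ≤ (C : EReal))
    (ha : 0 ≤ a) (hC : 0 ≤ C) (hδ : 0 < δ) (hr : 0 ≤ r) (hrs : r ≤ s) (hrδ : r ≤ δ / 2)
    (hM : ∀ i, M i ∈ stdSimplex ℝ (Fin k)) (hMδ : ∀ i j, δ ≤ M i j)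
    (hπ : ∑ i, π i = 1) (hπM : ∀ j, ∑ i, π i * M i j = π j) {i : Fin k}
    (hv : 0 < (1 - η) * (m * π i)) (hcount : (1 + k * (ε * m)) / δ ≤ η * (m * π i))
    (hdev : ε * m ≤ r * ((1 - η) * (m * π i))) (x : Fin (m + 1) → Fin k) :
    fDiv f (M i) (empiricalRow δ x i) ≤
      ((a / ((1 - η) * (m * π i)) ^ 2 * ∑ j, transSum (transDev M i j) x ^ 2 / M i j +
        C * ∑ ij : Fin k × Fin k,
          if ε * m < |transSum (transDev M ij.1 ij.2) x| then 1 else 0 : ℝ) : EReal) := by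
  have hM0 : ∀ j, 0 ≤ M i j := (hM i).1
  have hquad0 : 0 ≤ a / ((1 - η) * (m * π i)) ^ 2 *
      ∑ j, transSum (transDev M i j) x ^ 2 / M i j :=
    mul_nonneg (by positivity) (Finset.sum_nonneg fun j _ => div_nonneg (sq_nonneg _) (hM0 j))
  have hind0 : ∀ ij : Fin k × Fin k,
      (0 : ℝ) ≤ if ε * m < |transSum (transDev M ij.1 ij.2) x| then 1 else 0 := fun ij => by
    split_ifs <;> norm_num
  by_cases hgood : ∀ i j, |transSum (transDev M i j) x| ≤ ε * m
  · have hvisit := abs_visitCount_sub_le hδ hMδ (fun i => (hM i).2) hπ hπM hgood i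
    rw [Fintype.card_fin] at hvisit
    refine (fDiv_empiricalRow_le hquad ha hδ hr hrs hrδ (hM i).2 (hMδ i) hv
      (by linarith [neg_le_of_abs_le hvisit]) fun j => (hgood i j).trans hdev).trans ?_
    exact EReal.coe_le_coe (le_add_of_nonneg_right
      (mul_nonneg hC (Finset.sum_nonneg fun ij _ => hind0 ij)))
  · push Not at hgood
    obtain ⟨i', j', hbad⟩ := hgood
    refine (hconst (M i) _ (hM i) (empiricalRow_mem_stdSimplex hδ.le x i)
      (fun j => (half_le_self hδ.le).trans (hMδ i j))
      (le_empiricalRow (hM i).2 (hMδ i) x i)).trans (EReal.coe_le_coe ?_)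
    have hone := Finset.single_le_sum (fun ij _ => hind0 ij) (Finset.mem_univ (i', j'))
    rw [if_pos hbad] at hone
    exact (le_mul_of_one_le_right hC hone).trans (le_add_of_nonneg_left hquad0)

theorem HasConvexExpansion.exists_estimator (hf : HasConvexExpansion f c A) (hk : 0 < k)
    (hδ : 0 < δ) (hρ : 0 < ρ) (hη0 : 0 < η) (hη1 : η < 1) :
    ∃ C c : ℝ, 0 ≤ C ∧ 0 < c ∧ ∀ᶠ m in atTop, ∃ E : Estimator (m + 1) k,
      ∀ P ∈ chainClass k δ ρ, ∀ i, stateRisk (fDiv f) P E i ≤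
        (((1 + η) * (A / 2) / ((1 - η) * (m * P.stat i)) ^ 2 *
          ((k - 1) * (m * P.stat i + 1 / δ)) + C * Real.exp (-(c * m)) : ℝ) : EReal) := by
  have hA := hf.pos
  obtain ⟨C, hC0, hC⟩ := hf.exists_fDiv_le_const k (half_pos hδ)
  obtain ⟨s, hs0, hs⟩ := hf.exists_fDiv_le_quadratic k (half_pos hδ) hη0
  have hr : 0 < min s (δ / 2) := by positivity
  obtain ⟨ε, hε0, hε⟩ :=
    exists_deviation_scale (by exact_mod_cast hk : (0 : ℝ) < k) hδ hρ hη0 hη1 hr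
  refine ⟨C * (2 * k ^ 2), ε ^ 2 / 2, by positivity, by positivity, ?_⟩
  filter_upwards [hε, eventually_gt_atTop 0] with m hm hm0
  refine ⟨empiricalEstimator hδ.le, fun P ⟨hPδ, hPρ⟩ i => ?_⟩
  have hstat : ρ ≤ P.stat i := hPρ.2 ⟨i, rfl⟩
  have hv : 0 < (1 - η) * (m * P.stat i) :=
    mul_pos (sub_pos.2 hη1) (mul_pos (by exact_mod_cast hm0) (hρ.trans_le hstat))
  obtain ⟨hcount, hdev⟩ := hm _ hstat
  refine (stateRisk_le_pathMean fun x => fDiv_empiricalRow_le_add_sum_deviation hs hC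
    (by positivity) hC0 hδ hr.le (min_le_left _ _) (min_le_right _ _) P.prob_mem_stdSimplex hPδ
    P.stat_mem.2 P.sum_stat_mul_prob hv hcount hdev x).trans (EReal.coe_le_coe ?_)
  have hsq := pathMean_sum_transDev_sq_div_le (m := m) P.init_mem P.prob_mem_stdSimplex hδ hPδ
    P.stat_mem.2 P.sum_stat_mul_prob i
  have hbad := pathMean_sum_deviation_le (m := m) P.init_mem P.prob_mem_stdSimplex hε0.le
  rw [Fintype.card_fin] at hsq hbad
  rw [pathMean_add, pathMean_const_mul, pathMean_const_mul, mul_assoc C]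
  gcongr

end UpperBound

section UpperAsymptotics

variable {k : ℕ} {δ ρ c A η : ℝ} {f : ℝ → ℝ}

theorem AsympLE.of_forall_eventually {a : ℕ → EReal} {b : ℕ → ℝ} (hb : ∀ᶠ n in atTop, 0 < b n)
    (h : ∀ η : ℝ, 0 < η → ∀ᶠ n in atTop, a n ≤ ((b n * (1 + η) : ℝ) : EReal)) :
    AsympLE a fun n => (b n : EReal) := by
  refine ⟨fun n => max 0 ((a n).toReal / b n - 1), ?_, ?_⟩
  · refine tendsto_order.2 ⟨fun e he => .of_forall fun n => he.trans_le (le_max_left _ _),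
      fun e he => ?_⟩
    filter_upwards [hb, h (e / 2) (half_pos he)] with n hbn han
    have hle : (a n).toReal ≤ b n * (1 + e / 2) := by
      rcases eq_or_ne (a n) ⊥ with hbot | hbot
      · rw [hbot, EReal.toReal_bot]
        positivity
      · exact EReal.toReal_le_toReal han hbot (EReal.coe_ne_top _)
    rw [← div_le_iff₀' hbn] at hle
    exact max_lt he (by linarith)
  · filter_upwards [hb, h 1 one_pos] with n hbn han
    refine (EReal.le_coe_toReal (han.trans_lt (EReal.coe_lt_top _)).ne).trans ?_
    rw [← EReal.coe_mul, EReal.coe_le_coe_iff, ← div_le_iff₀' hbn, ← sub_le_iff_le_add']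
    exact le_max_right _ _

theorem tendsto_add_one_mul_exp_neg_mul_atTop (hc : 0 < c) :
    Tendsto (fun m : ℕ => ((m : ℝ) + 1) * Real.exp (-(c * m))) atTop (𝓝 0) := by
  have hreal : Tendsto (fun x : ℝ => (x + 1) * Real.exp (-(c * x))) atTop (𝓝 0) := by
    have hsum := (tendsto_rpow_mul_exp_neg_mul_atTop_nhds_zero 1 c hc).add
      (tendsto_rpow_mul_exp_neg_mul_atTop_nhds_zero 0 c hc)
    simpa only [add_zero, Real.rpow_one, Real.rpow_zero, ← add_mul, neg_mul] using hsum
  exact hreal.comp tendsto_natCast_atTop_atTop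

theorem eventually_leading_add_exp_le {κ κ' C : ℝ} (hδ : 0 < δ) (hρ : 0 < ρ) (hc : 0 < c)
    (hC : 0 ≤ C) (hκ : 0 ≤ κ) (hκκ' : κ < κ') :
    ∀ᶠ m : ℕ in atTop, ∀ t, ρ ≤ t → t ≤ 1 →
      κ / (m * t) ^ 2 * (m * t + 1 / δ) + C * Real.exp (-(c * m)) ≤
        κ' / ((m + 1 : ℕ) * t) := by
  have hinv : Tendsto (fun m : ℕ => 1 / (m : ℝ)) atTop (𝓝 0) := tendsto_one_div_atTop_nhds_zero_nat
  have hlim : Tendsto (fun m : ℕ => (1 + 1 / (m : ℝ)) * κ * (1 + 1 / (δ * ρ) * (1 / (m : ℝ))) +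
      C * ((m + 1) * Real.exp (-(c * m)))) atTop (𝓝 κ) := by
    simpa using (((hinv.const_add 1).mul_const κ).mul ((hinv.const_mul _).const_add 1)).add
      ((tendsto_add_one_mul_exp_neg_mul_atTop hc).const_mul C)
  filter_upwards [hlim.eventually_lt_const hκκ', eventually_gt_atTop 0] with m hm hm0 t ht ht1
  have : (0 : ℝ) < m := by exact_mod_cast hm0
  have ht0 : 0 < t := hρ.trans_le ht
  push_cast
  rw [le_div_iff₀ (by positivity), add_mul]
  refine le_trans (add_le_add ?_ ?_) hm.le
  · calc κ / (m * t) ^ 2 * (m * t + 1 / δ) * ((m + 1) * t)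
        = (1 + 1 / (m : ℝ)) * κ * (1 + 1 / (δ * t) * (1 / m)) := by field_simp
      _ ≤ (1 + 1 / (m : ℝ)) * κ * (1 + 1 / (δ * ρ) * (1 / m)) := by gcongr
  · calc C * Real.exp (-(c * m)) * ((m + 1) * t)
        = C * ((m + 1) * Real.exp (-(c * m))) * t := by ring
      _ ≤ C * ((m + 1) * Real.exp (-(c * m))) := mul_le_of_le_one_right (by positivity) ht1

theorem exists_one_add_div_one_sub_sq_lt (hη : 0 < η) :
    ∃ ζ : ℝ, 0 < ζ ∧ ζ < 1 ∧ (1 + ζ) / (1 - ζ) ^ 2 < 1 + η := by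
  have hcont : ContinuousAt (fun ζ : ℝ => (1 + ζ) / (1 - ζ) ^ 2) 0 :=
    ContinuousAt.div (by fun_prop) (by fun_prop) (by norm_num)
  have hlt : ∀ᶠ ζ in 𝓝[>] (0 : ℝ), (1 + ζ) / (1 - ζ) ^ 2 < 1 + η :=
    (hcont.eventually_lt_const (by simpa using hη)).filter_mono nhdsWithin_le_nhds
  have hone : ∀ᶠ ζ in 𝓝[>] (0 : ℝ), ζ < 1 := nhdsWithin_le_nhds (eventually_lt_nhds one_pos)
  obtain ⟨ζ, hζ0, hζ1, hζ⟩ := (eventually_mem_nhdsWithin.and (hone.and hlt)).exists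
  exact ⟨ζ, hζ0, hζ1, hζ⟩

theorem HasConvexExpansion.eventually_exists_estimator (hf : HasConvexExpansion f c A)
    (hk : 2 ≤ k) (hδ : 0 < δ) (hρ : 0 < ρ) (hη : 0 < η) :
    ∀ᶠ n in atTop, ∃ E : Estimator n k, ∀ P ∈ chainClass k δ ρ, ∀ i, stateRisk (fDiv f) P E i ≤
        (((1 + η) * ((A / 2) * (k - 1)) / (n * P.stat i) : ℝ) : EReal) := by
  have hA := hf.pos
  have hk1 : (0 : ℝ) < k - 1 := sub_pos.2 (by exact_mod_cast hk)
  obtain ⟨ζ, hζ0, hζ1, hζ⟩ := exists_one_add_div_one_sub_sq_lt hη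
  obtain ⟨C, c', hC, hc', hE⟩ := hf.exists_estimator (by omega : 0 < k) hδ hρ hζ0 hζ1
  rw [← Filter.map_add_atTop_eq_nat 1, Filter.eventually_map]
  filter_upwards [hE, eventually_leading_add_exp_le hδ hρ hc' hC (by positivity)
    (mul_lt_mul_of_pos_right hζ (by positivity : 0 < A / 2 * (k - 1)))] with m ⟨E, hE⟩ hm
  refine ⟨E, fun P hP i => (hE P hP i).trans (EReal.coe_le_coe ?_)⟩
  convert hm (P.stat i) (hP.2.2 ⟨i, rfl⟩) (mem_Icc_of_mem_stdSimplex P.stat_mem i).2 using 2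
  rw [mul_pow]
  simp only [div_eq_mul_inv, mul_inv]
  ring

theorem HasConvexExpansion.minimaxWorst_asympLE (hf : HasConvexExpansion f c A) (hk : 2 ≤ k)
    (hδ : 0 < δ) (hρ : 0 < ρ) :
    AsympLE (minimaxWorst (fDiv f) (chainClass k δ ρ))
      (fun n => ((((k : ℝ) - 1) * A / (2 * n * ρ) : ℝ) : EReal)) := by
  have hA := hf.pos
  have hk1 : (0 : ℝ) < k - 1 := sub_pos.2 (by exact_mod_cast hk)
  refine AsympLE.of_forall_eventually ?_ fun η hη => ?_
  · filter_upwards [eventually_gt_atTop 0] with n hn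
    positivity
  filter_upwards [hf.eventually_exists_estimator hk hδ hρ hη, eventually_gt_atTop 0]
    with n ⟨E, hE⟩ hn
  refine (iInf_le _ E).trans (iSup₂_le fun P hP => iSup_le fun i => (hE P hP i).trans
    (EReal.coe_le_coe ?_))
  have hstat : ρ ≤ P.stat i := hP.2.2 ⟨i, rfl⟩
  calc (1 + η) * (A / 2 * (k - 1)) / (n * P.stat i)
      ≤ (1 + η) * (A / 2 * (k - 1)) / (n * ρ) := by gcongr
    _ = (k - 1) * A / (2 * n * ρ) * (1 + η) := by field_simp

theorem HasConvexExpansion.minimaxWeighted_asympLE (hf : HasConvexExpansion f c A) (hk : 2 ≤ k)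
    (hδ : 0 < δ) (hρ : 0 < ρ) :
    AsympLE (minimaxWeighted (fDiv f) (chainClass k δ ρ))
      (fun n => ((((k : ℝ) - 1) * k * A / (2 * n) : ℝ) : EReal)) := by
  have hA := hf.pos
  have hk1 : (0 : ℝ) < k - 1 := sub_pos.2 (by exact_mod_cast hk)
  refine AsympLE.of_forall_eventually ?_ fun η hη => ?_
  · filter_upwards [eventually_gt_atTop 0] with n hn
    positivity
  filter_upwards [hf.eventually_exists_estimator hk hδ hρ hη, eventually_gt_atTop 0]
    with n ⟨E, hE⟩ hn
  refine (iInf_le _ E).trans (iSup₂_le fun P hP => ?_)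
  have hterm : ∀ i, (P.stat i : EReal) * stateRisk (fDiv f) P E i ≤
      (((1 + η) * (A / 2 * (k - 1)) / n : ℝ) : EReal) := by
    intro i
    have hstat : 0 < P.stat i := hρ.trans_le (hP.2.2 ⟨i, rfl⟩)
    refine (mul_le_mul_of_nonneg_left (hE P hP i) (EReal.coe_nonneg.2 hstat.le)).trans_eq ?_
    rw [← EReal.coe_mul]
    congr 1
    field_simp
  refine (Finset.sum_le_sum fun i _ => hterm i).trans_eq ?_
  rw [← coe_sum_eReal, Finset.sum_const, Finset.card_univ, Fintype.card_fin, nsmul_eq_mul]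
  congr 1
  field_simp

end UpperAsymptotics

section QuarticPrior

open MeasureTheory

variable {e : ℝ}

theorem integral_quartic (e : ℝ) : ∫ t in (-e)..e, (e ^ 2 - t ^ 2) ^ 2 = 16 * e ^ 5 / 15 := by
  have hexpand : ∀ t : ℝ, (e ^ 2 - t ^ 2) ^ 2 = e ^ 4 - 2 * e ^ 2 * t ^ 2 + t ^ 4 := fun t => by
    ring
  simp only [hexpand]
  rw [intervalIntegral.integral_add (by apply Continuous.intervalIntegrable; fun_prop)
    (by apply Continuous.intervalIntegrable; fun_prop),
    intervalIntegral.integral_sub (by apply Continuous.intervalIntegrable; fun_prop)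
    (by apply Continuous.intervalIntegrable; fun_prop), intervalIntegral.integral_const_mul]
  simp only [intervalIntegral.integral_const, integral_pow, smul_eq_mul]
  norm_num
  ring

/-- The prior on a parameter in `[-e, e]`, with density proportional to `(e ^ 2 - t ^ 2) ^ 2`. The
density vanishes at the end points, and its Fisher information is `10 / e ^ 2`. -/
def quarticPrior (e : ℝ) : Measure ℝ :=
  (volume.restrict (Ioc (-e) e)).withDensity fun t =>
    ENNReal.ofReal (15 / (16 * e ^ 5) * (e ^ 2 - t ^ 2) ^ 2)

theorem integral_quarticPrior (he : 0 < e) (g : ℝ → ℝ) :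
    ∫ t, g t ∂quarticPrior e =
      15 / (16 * e ^ 5) * ∫ t in (-e)..e, (e ^ 2 - t ^ 2) ^ 2 * g t := by
  rw [quarticPrior, integral_withDensity_eq_integral_toReal_smul (by fun_prop)
    (ae_of_all _ fun _ => ENNReal.ofReal_lt_top), intervalIntegral.integral_of_le (by linarith),
    ← integral_const_mul]
  refine integral_congr_ae (ae_of_all _ fun t => ?_)
  beta_reduce
  rw [ENNReal.toReal_ofReal (by positivity), smul_eq_mul, mul_assoc]

theorem isProbabilityMeasure_quarticPrior (he : 0 < e) :
    IsProbabilityMeasure (quarticPrior e) := by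
  refine ⟨?_⟩
  rw [quarticPrior, withDensity_apply _ MeasurableSet.univ, Measure.restrict_univ,
    ← ofReal_integral_eq_lintegral_ofReal, ← intervalIntegral.integral_of_le (by linarith),
    intervalIntegral.integral_const_mul, integral_quartic]
  · rw [ENNReal.ofReal_eq_one]
    field_simp
  · exact Continuous.integrableOn_Ioc (by fun_prop)
  · exact ae_of_all _ fun t => by positivity

theorem ae_quarticPrior_mem_Icc (e : ℝ) : ∀ᵐ t ∂quarticPrior e, t ∈ Icc (-e) e := by
  refine (withDensity_absolutelyContinuous _ _).ae_le ?_
  filter_upwards [ae_restrict_mem measurableSet_Ioc] with t ht using Ioc_subset_Icc_self ht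

end QuarticPrior

section VanTrees

variable {α : Type*} {m : ℕ} {b : α → ℝ}

/-- The transition weights `A + t H`, depending affinely on the parameter `t`. -/
def lineKernel (A H : α → α → ℝ) (t : ℝ) (i j : α) : ℝ := A i j + t * H i j

/-- The score of a path: the logarithmic derivative of its weight when the transition weights `M`
move in the direction `H`. -/
def score (M H : α → α → ℝ) (x : Fin (m + 1) → α) : ℝ :=
  transSum (fun i j => H i j / M i j) x

theorem hasDerivAt_pathWeight_lineKernel {A H : α → α → ℝ} {t : ℝ}
    (hM : ∀ i j, lineKernel A H t i j ≠ 0) (x : Fin (m + 1) → α) :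
    HasDerivAt (fun t => pathWeight b (lineKernel A H t) m x)
      (pathWeight b (lineKernel A H t) m x * score (lineKernel A H t) H x) t := by
  unfold pathWeight score transSum
  have hentry : ∀ s ∈ (Finset.univ : Finset (Fin m)), HasDerivAt
      (fun t => lineKernel A H t (x s.castSucc) (x s.succ)) (H (x s.castSucc) (x s.succ)) t :=
    fun s _ => (((hasDerivAt_id t).mul_const _).const_add _).congr_deriv (one_mul _)
  refine ((HasDerivAt.fun_finsetProd hentry).const_mul (b (x 0))).congr_deriv ?_
  rw [mul_assoc]
  congr 1
  rw [Finset.mul_sum]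
  refine Finset.sum_congr rfl fun s _ => ?_
  rw [← Finset.mul_prod_erase Finset.univ (fun s : Fin m =>
    lineKernel A H t (x s.castSucc) (x s.succ)) (Finset.mem_univ s), smul_eq_mul]
  have := hM (x s.castSucc) (x s.succ)
  field_simp

variable [Fintype α]

theorem hasDerivAt_pathMean_lineKernel {A H : α → α → ℝ} {t : ℝ}
    (hM : ∀ i j, lineKernel A H t i j ≠ 0) {Y : ℝ → (Fin (m + 1) → α) → ℝ}
    {Y' : (Fin (m + 1) → α) → ℝ} (hY : ∀ x, HasDerivAt (fun t => Y t x) (Y' x) t) :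
    HasDerivAt (fun t => pathMean b (lineKernel A H t) m (Y t))
      (pathMean b (lineKernel A H t) m
        fun x => score (lineKernel A H t) H x * Y t x + Y' x) t := by
  refine (HasDerivAt.fun_sum fun x _ =>
    (hasDerivAt_pathWeight_lineKernel hM x).mul (hY x)).congr_deriv ?_
  exact Finset.sum_congr rfl fun x _ => by ring

theorem continuous_pathMean_lineKernel {A H : α → α → ℝ} {Y : ℝ → (Fin (m + 1) → α) → ℝ}
    (hY : ∀ x, Continuous fun t => Y t x) :
    Continuous fun t => pathMean b (lineKernel A H t) m (Y t) := by
  unfold pathMean pathWeight lineKernel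
  fun_prop

variable {M H : α → α → ℝ} {I J : ℝ}

theorem sum_mul_div_eq_zero (hM0 : ∀ i j, 0 < M i j) (hH : ∀ i, ∑ j, H i j = 0) (i : α) :
    ∑ j, M i j * (H i j / M i j) = 0 := by
  simp only [mul_div_cancel₀ _ (hM0 _ _).ne', hH]

theorem pathMean_score_sq_le (hb : b ∈ stdSimplex ℝ α) (hM : ∀ i, M i ∈ stdSimplex ℝ α)
    (hM0 : ∀ i j, 0 < M i j) (hH : ∀ i, ∑ j, H i j = 0)
    (hIb : ∑ i, b i * ∑ j, H i j ^ 2 / M i j ≤ I)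
    (hIM : ∀ i, ∑ l, M i l * ∑ j, H l j ^ 2 / M l j ≤ I) :
    pathMean b M m (fun x => score M H x ^ 2) ≤ m * I := by
  have hinfo : ∀ i, ∑ j, M i j * (H i j / M i j) ^ 2 = ∑ j, H i j ^ 2 / M i j := fun i => by
    refine Finset.sum_congr rfl fun j _ => ?_
    have := (hM0 i j).ne'
    field_simp
  unfold score
  rw [pathMean_transSum_sq _ (fun i => (hM i).2) (sum_mul_div_eq_zero hM0 hH)]
  simp only [hinfo]
  exact pathMean_transSum_le hb hM _ hIb hIM

/-- The Cauchy–Schwarz step of van Trees' inequality, linearized with a free parameter `r`. -/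
theorem two_mul_pathMean_score_mul_le (hb : b ∈ stdSimplex ℝ α) (hM : ∀ i, M i ∈ stdSimplex ℝ α)
    (hM0 : ∀ i j, 0 < M i j) (hH : ∀ i, ∑ j, H i j = 0)
    (hJ : pathMean b M m (fun x => score M H x ^ 2) ≤ J)
    (Y : (Fin (m + 1) → α) → ℝ) (r u v : ℝ) :
    2 * r * pathMean b M m (fun x => (u * score M H x + v) * (u * Y x)) ≤
      u ^ 2 * pathMean b M m (fun x => Y x ^ 2) + r ^ 2 * (u ^ 2 * J + v ^ 2) := by
  have hmean : pathMean b M m (score M H) = 0 :=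
    pathMean_transSum_eq_zero _ (fun i => (hM i).2) (sum_mul_div_eq_zero hM0 hH)
  have hpointwise : ∀ x, 2 * r * ((u * score M H x + v) * (u * Y x)) ≤
      u ^ 2 * Y x ^ 2 + r ^ 2 * (u ^ 2 * score M H x ^ 2 + 2 * u * v * score M H x + v ^ 2) :=
    fun x => by nlinarith [sq_nonneg (u * Y x - r * (u * score M H x + v))]
  have hle := pathMean_mono (m := m) hb.1 (fun i => (hM i).1) hpointwise
  simp only [pathMean_add, pathMean_const_mul, pathMean_const hb.2 fun i => (hM i).2, hmean,
    mul_zero, add_zero] at hle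
  refine hle.trans ?_
  gcongr

variable {A : α → α → ℝ} {e : ℝ}

theorem lineKernel_mem_stdSimplex {t : ℝ} {i : α} (hA : ∑ j, A i j = 1) (hH : ∑ j, H i j = 0)
    (h0 : ∀ j, 0 ≤ lineKernel A H t i j) : lineKernel A H t i ∈ stdSimplex ℝ α := by
  refine ⟨h0, ?_⟩
  simp only [lineKernel, Finset.sum_add_distrib, ← Finset.mul_sum, hA, hH, mul_zero, add_zero]

/-- Integration by parts against the prior, whose density vanishes at both end points. -/
theorem integral_van_trees_nonneg (he : 0 ≤ e) (hb : b ∈ stdSimplex ℝ α)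
    (hA : ∀ i, ∑ j, A i j = 1) (hH : ∀ i, ∑ j, H i j = 0)
    (hM0 : ∀ t ∈ Icc (-e) e, ∀ i j, 0 < lineKernel A H t i j)
    (hJ : ∀ t ∈ Icc (-e) e,
      pathMean b (lineKernel A H t) m (fun x => score (lineKernel A H t) H x ^ 2) ≤ J)
    (T : (Fin (m + 1) → α) → ℝ) (c h r : ℝ) :
    0 ≤ ∫ t in (-e)..e, ((e ^ 2 - t ^ 2) ^ 2 *
          pathMean b (lineKernel A H t) m (fun x => (T x - (c + t * h)) ^ 2) +
        r ^ 2 * ((e ^ 2 - t ^ 2) ^ 2 * J + 16 * t ^ 2) - 2 * r * h * (e ^ 2 - t ^ 2) ^ 2) := by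
  have hprior : ∀ t : ℝ, HasDerivAt (fun t => (e ^ 2 - t ^ 2) ^ 2) (-4 * t * (e ^ 2 - t ^ 2)) t :=
    fun t => by
      refine (((hasDerivAt_pow 2 t).const_sub (e ^ 2)).fun_pow 2).congr_deriv ?_
      simp only [Nat.cast_ofNat, Nat.add_one_sub_one, pow_one]
      ring
  have herror : ∀ x t, HasDerivAt (fun t => T x - (c + t * h)) (-h) t := fun x t => by
    simpa using (((hasDerivAt_id t).mul_const h).const_add c).const_sub (T x)
  have hderiv : ∀ t ∈ Icc (-e) e, HasDerivAt _ _ t := fun t ht =>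
    (hasDerivAt_pathMean_lineKernel (b := b) (fun i j => (hM0 t ht i j).ne')
      fun x => (herror x t).mul (hprior t)).const_mul (2 * r)
  have hparts := intervalIntegral.sub_le_integral_of_hasDeriv_right_of_le
    (φ := fun t => (e ^ 2 - t ^ 2) ^ 2 *
        pathMean b (lineKernel A H t) m (fun x => (T x - (c + t * h)) ^ 2) +
      r ^ 2 * ((e ^ 2 - t ^ 2) ^ 2 * J + 16 * t ^ 2) - 2 * r * h * (e ^ 2 - t ^ 2) ^ 2)
    (show -e ≤ e by linarith)
    (fun t ht => (hderiv t ht).continuousAt.continuousWithinAt)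
    (fun t ht => (hderiv t (Ioo_subset_Icc_self ht)).hasDerivWithinAt) ?_ fun t ht => ?_
  · simpa [pathMean] using hparts
  · have hmean := continuous_pathMean_lineKernel (b := b) (A := A) (H := H) (m := m)
      (Y := fun t x => (T x - (c + t * h)) ^ 2) fun x => by fun_prop
    exact ContinuousOn.integrableOn_Icc (Continuous.continuousOn (by fun_prop))
  · have ht := Ioo_subset_Icc_self ht
    have hM := fun i => lineKernel_mem_stdSimplex (hA i) (hH i) fun j => (hM0 t ht i j).le
    have hCS := two_mul_pathMean_score_mul_le hb hM (hM0 t ht) hH (hJ t ht)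
      (fun x => T x - (c + t * h)) r (e ^ 2 - t ^ 2) (-4 * t)
    have hsplit : ∀ x, score (lineKernel A H t) H x * ((T x - (c + t * h)) * (e ^ 2 - t ^ 2) ^ 2) +
        (-h * (e ^ 2 - t ^ 2) ^ 2 + (T x - (c + t * h)) * (-4 * t * (e ^ 2 - t ^ 2))) =
        ((e ^ 2 - t ^ 2) * score (lineKernel A H t) H x + -4 * t) *
          ((e ^ 2 - t ^ 2) * (T x - (c + t * h))) + -h * (e ^ 2 - t ^ 2) ^ 2 := fun x => by ring
    simp only [Pi.mul_apply, hsplit, pathMean_add, pathMean_const hb.2 fun i => (hM i).2]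
    linarith

theorem van_trees (he : 0 < e) (hb : b ∈ stdSimplex ℝ α)
    (hA : ∀ i, ∑ j, A i j = 1) (hH : ∀ i, ∑ j, H i j = 0)
    (hM0 : ∀ t ∈ Icc (-e) e, ∀ i j, 0 < lineKernel A H t i j) (hJ0 : 0 ≤ J)
    (hJ : ∀ t ∈ Icc (-e) e,
      pathMean b (lineKernel A H t) m (fun x => score (lineKernel A H t) H x ^ 2) ≤ J)
    (T : (Fin (m + 1) → α) → ℝ) (c h : ℝ) :
    h ^ 2 / (J + 10 / e ^ 2) ≤
      ∫ t, pathMean b (lineKernel A H t) m (fun x => (T x - (c + t * h)) ^ 2)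
        ∂quarticPrior e := by
  rw [integral_quarticPrior he]
  have hmean := continuous_pathMean_lineKernel (b := b) (A := A) (H := H) (m := m)
    (Y := fun t x => (T x - (c + t * h)) ^ 2) fun x => by fun_prop
  have hparts :=
    integral_van_trees_nonneg he.le hb hA hH hM0 hJ T c h (h / (J + 10 / e ^ 2))
  have hvariance : ∫ t in (-e)..e, t ^ 2 = 2 * e ^ 3 / 3 := by
    rw [integral_pow]
    norm_num
    ring
  rw [intervalIntegral.integral_sub (by apply Continuous.intervalIntegrable; fun_prop)
      (by apply Continuous.intervalIntegrable; fun_prop),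
    intervalIntegral.integral_add (by apply Continuous.intervalIntegrable; fun_prop)
      (by apply Continuous.intervalIntegrable; fun_prop),
    intervalIntegral.integral_const_mul, intervalIntegral.integral_const_mul,
    intervalIntegral.integral_add (by apply Continuous.intervalIntegrable; fun_prop)
      (by apply Continuous.intervalIntegrable; fun_prop),
    intervalIntegral.integral_mul_const, intervalIntegral.integral_const_mul,
    integral_quartic, hvariance] at hparts
  set X := ∫ t in (-e)..e, (e ^ 2 - t ^ 2) ^ 2 *
    pathMean b (lineKernel A H t) m (fun x => (T x - (c + t * h)) ^ 2)
  have hK : 0 < J + 10 / e ^ 2 := by positivity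
  have hinformation : 16 * e ^ 5 / 15 * J + 16 * (2 * e ^ 3 / 3) =
      16 * e ^ 5 / 15 * (J + 10 / e ^ 2) := by
    field_simp
    ring
  rw [hinformation] at hparts
  have hscaled : 16 * e ^ 5 / 15 * (h ^ 2 / (J + 10 / e ^ 2)) ≤ X := by
    refine le_of_sub_nonneg (hparts.trans_eq ?_)
    field_simp
    ring
  rw [div_mul_eq_mul_div, le_div_iff₀ (by positivity)]
  linarith

end VanTrees

section ProductMeasure

open MeasureTheory

theorem preimage_update_univ_pi {ι : Type*} [DecidableEq ι] {X : ι → Type*} (s : ∀ i, Set (X i))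
    (a : ι) :
    (fun p : (∀ i, X i) × X a => Function.update p.1 a p.2) ⁻¹' univ.pi s =
      univ.pi (Function.update s a univ) ×ˢ s a := by
  ext ⟨x, t⟩
  simp only [mem_preimage, mem_univ_pi, mem_prod]
  constructor
  · refine fun h => ⟨fun i => ?_, by simpa using h a⟩
    rcases eq_or_ne i a with rfl | hi
    · simp
    · simpa [hi] using h i
  · rintro ⟨h, ht⟩ i
    rcases eq_or_ne i a with rfl | hi
    · simpa using ht
    · simpa [hi] using h i

variable {ι : Type*} [Fintype ι]

theorem measurePreserving_update_pi [DecidableEq ι] {X : ι → Type*} [∀ i, MeasurableSpace (X i)]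
    (ν : ∀ i, Measure (X i)) [∀ i, SigmaFinite (ν i)] (a : ι) [IsProbabilityMeasure (ν a)] :
    MeasurePreserving (fun p : (∀ i, X i) × X a => Function.update p.1 a p.2)
      ((Measure.pi ν).prod (ν a)) (Measure.pi ν) := by
  refine ⟨measurable_update', (Measure.pi_eq fun s hs => ?_).symm⟩
  rw [Measure.map_apply measurable_update' (MeasurableSet.univ_pi hs), preimage_update_univ_pi,
    Measure.prod_prod, Measure.pi_pi, ← Finset.mul_prod_erase _ _ (Finset.mem_univ a),
    ← Finset.mul_prod_erase Finset.univ (fun i => ν i (s i)) (Finset.mem_univ a),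
    Function.update_self, measure_univ, one_mul, mul_comm]
  congr 1
  exact Finset.prod_congr rfl fun i hi => by
    rw [Function.update_of_ne (Finset.ne_of_mem_erase hi)]

variable {ν : Measure ℝ} [IsProbabilityMeasure ν] {e : ℝ}

theorem ae_pi_mem_Icc (hν : ∀ᵐ t ∂ν, t ∈ Icc (-e) e) :
    ∀ᵐ θ ∂Measure.pi fun _ : ι => ν, ∀ i, θ i ∈ Icc (-e) e :=
  eventually_all.2 fun _ => Measure.tendsto_eval_ae_ae.eventually hν

theorem integrable_pi_of_continuous (hν : ∀ᵐ t ∂ν, t ∈ Icc (-e) e) {G : (ι → ℝ) → ℝ}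
    (hG : Continuous G) : Integrable G (Measure.pi fun _ => ν) := by
  obtain ⟨C, hC⟩ := (isCompact_univ_pi fun _ : ι => isCompact_Icc (a := -e)
    (b := e)).exists_bound_of_continuousOn hG.continuousOn
  refine Integrable.of_bound hG.measurable.aestronglyMeasurable C ?_
  filter_upwards [ae_pi_mem_Icc hν] with θ hθ using hC θ fun i _ => hθ i

variable [DecidableEq ι]

theorem le_integral_pi_of_forall_line (hν : ∀ᵐ t ∂ν, t ∈ Icc (-e) e) {G : (ι → ℝ) → ℝ}
    (hG : Continuous G) {L : ℝ} (a : ι)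
    (hL : ∀ θ : ι → ℝ, (∀ i, θ i ∈ Icc (-e) e) → L ≤ ∫ t, G (Function.update θ a t) ∂ν) :
    L ≤ ∫ θ, G θ ∂Measure.pi fun _ => ν := by
  have hmp := measurePreserving_update_pi (fun _ : ι => ν) a
  have hG' := hG.measurable.aestronglyMeasurable (μ := Measure.pi fun _ => ν)
  have hint := (hmp.integrable_comp hG').2 (integrable_pi_of_continuous hν hG)
  have hresample : ∫ θ, G θ ∂(Measure.pi fun _ => ν) =
      ∫ θ, ∫ t, G (Function.update θ a t) ∂ν ∂Measure.pi fun _ => ν := by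
    conv_lhs => rw [← hmp.map_eq]
    exact (integral_map hmp.measurable.aemeasurable (by rwa [hmp.map_eq])).trans
      (integral_prod _ hint)
  rw [hresample]
  calc L = ∫ _, L ∂Measure.pi fun _ : ι => ν := by simp
    _ ≤ _ := integral_mono_ae (integrable_const _) hint.integral_prod_left
        ((ae_pi_mem_Icc hν).mono hL)

theorem sum_le_of_forall_line (hν : ∀ᵐ t ∂ν, t ∈ Icc (-e) e) {G : ι → (ι → ℝ) → ℝ}
    (hG : ∀ a, Continuous (G a)) {w L : ι → ℝ} (hw : ∀ a, 0 ≤ w a) {B : ℝ}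
    (hL : ∀ a (θ : ι → ℝ), (∀ i, θ i ∈ Icc (-e) e) →
      L a ≤ ∫ t, G a (Function.update θ a t) ∂ν)
    (hB : ∀ θ : ι → ℝ, (∀ i, θ i ∈ Icc (-e) e) → ∑ a, w a * G a θ ≤ B) :
    ∑ a, w a * L a ≤ B := by
  have hint := fun a => (integrable_pi_of_continuous hν (hG a)).const_mul (w a)
  calc ∑ a, w a * L a ≤ ∑ a, w a * ∫ θ, G a θ ∂Measure.pi fun _ => ν := by
        gcongr with a
        · exact hw a
        · exact le_integral_pi_of_forall_line hν (hG a) a (hL a)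
    _ = ∫ θ, ∑ a, w a * G a θ ∂Measure.pi fun _ => ν := by
        simp only [integral_finsetSum _ fun a _ => hint a, integral_const_mul]
    _ ≤ ∫ _, B ∂Measure.pi fun _ => ν :=
        integral_mono_ae (integrable_finsetSum _ fun a _ => hint a) (integrable_const _)
          ((ae_pi_mem_Icc hν).mono hB)
    _ = B := by simp

end ProductMeasure

section PerturbedKernel

variable {α ι : Type*}

/-- The transition weights all of whose rows are `b`, moved by `θ a` in each direction `H a`. -/
def perturbedKernel [Fintype ι] (b : α → ℝ) (H : ι → α → α → ℝ) (θ : ι → ℝ) (i j : α) : ℝ :=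
  b j + ∑ a, θ a * H a i j

theorem perturbedKernel_zero [Fintype ι] (b : α → ℝ) (H : ι → α → α → ℝ) :
    perturbedKernel b H 0 = fun _ => b := by
  funext i j
  simp [perturbedKernel]

theorem perturbedKernel_update [Fintype ι] [DecidableEq ι] (b : α → ℝ) (H : ι → α → α → ℝ)
    (θ : ι → ℝ) (a : ι) (t : ℝ) :
    perturbedKernel b H (Function.update θ a t) =
      lineKernel (perturbedKernel b H (Function.update θ a 0)) (H a) t := by
  funext i j
  have hsplit : ∀ s, ∑ a', Function.update θ a s a' * H a' i j =
      s * H a i j + ∑ a' ∈ Finset.univ.erase a, θ a' * H a' i j := fun s => by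
    rw [← Finset.add_sum_erase _ _ (Finset.mem_univ a), Function.update_self]
    congr 1
    exact Finset.sum_congr rfl fun a' ha' => by
      rw [Function.update_of_ne (Finset.ne_of_mem_erase ha')]
  simp only [lineKernel, perturbedKernel, hsplit]
  ring

theorem sum_perturbedKernel [Fintype ι] [Fintype α] {b : α → ℝ} {H : ι → α → α → ℝ}
    (hb : ∑ j, b j = 1) (hH : ∀ a i, ∑ j, H a i j = 0) (θ : ι → ℝ) (i : α) :
    ∑ j, perturbedKernel b H θ i j = 1 := by
  unfold perturbedKernel
  rw [Finset.sum_add_distrib, Finset.sum_comm, hb]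
  simp only [← Finset.mul_sum, hH, mul_zero, Finset.sum_const_zero, add_zero]

theorem eventually_abs_perturbedKernel_sub_le [Fintype ι] [Finite α] (b : α → ℝ)
    (H : ι → α → α → ℝ) {r : ℝ} (hr : 0 < r) :
    ∀ᶠ θ in 𝓝 (0 : ι → ℝ), ∀ i j, |perturbedKernel b H θ i j - b j| ≤ r := by
  refine eventually_all.2 fun i => eventually_all.2 fun j => ?_
  have hcont : Continuous fun θ => |perturbedKernel b H θ i j - b j| := by
    unfold perturbedKernel
    fun_prop
  refine (hcont.tendsto 0).eventually_le_const ?_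
  simpa [perturbedKernel_zero] using hr

variable [Fintype α] {m : ℕ} {b : α → ℝ} {ζ : ℝ}

/-- The Fisher information of one transition in the direction `H`, when all rows are `b`. -/
def directionInfo (b : α → ℝ) (H : α → α → ℝ) : ℝ := ∑ i, b i * ∑ j, H i j ^ 2 / b j

theorem directionInfo_nonneg (hb : ∀ i, 0 < b i) (H : α → α → ℝ) : 0 ≤ directionInfo b H :=
  Finset.sum_nonneg fun i _ => mul_nonneg (hb i).le <|
    Finset.sum_nonneg fun j _ => div_nonneg (sq_nonneg _) (hb j).le

theorem directionInfo_pos (hb : ∀ i, 0 < b i) {H : α → α → ℝ} {i j : α} (hH : H i j ≠ 0) :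
    0 < directionInfo b H := by
  have hterm : ∀ l j, 0 ≤ H l j ^ 2 / b j := fun l j => div_nonneg (sq_nonneg _) (hb j).le
  refine Finset.sum_pos'
    (fun l _ => mul_nonneg (hb l).le (Finset.sum_nonneg fun j _ => hterm l j))
    ⟨i, Finset.mem_univ i, mul_pos (hb i) ?_⟩
  exact Finset.sum_pos' (fun j _ => hterm i j)
    ⟨j, Finset.mem_univ j, div_pos (by positivity) (hb j)⟩

theorem sum_mul_info_le_of_abs_sub_le (hb : ∀ i, 0 < b i) (hζ1 : ζ < 1)
    {M : α → α → ℝ} (hM : ∀ i j, |M i j - b j| ≤ ζ * b j) (H : α → α → ℝ) {v : α → ℝ}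
    (hv0 : ∀ i, 0 ≤ v i) (hv : ∀ i, v i ≤ (1 + ζ) * b i) :
    ∑ i, v i * ∑ j, H i j ^ 2 / M i j ≤ (1 + ζ) / (1 - ζ) * directionInfo b H := by
  have h1ζ : 0 < 1 - ζ := sub_pos.2 hζ1
  rw [directionInfo, Finset.mul_sum]
  refine Finset.sum_le_sum fun i _ => ?_
  have hrow : ∑ j, H i j ^ 2 / M i j ≤ (1 - ζ)⁻¹ * ∑ j, H i j ^ 2 / b j := by
    rw [Finset.mul_sum]
    refine Finset.sum_le_sum fun j _ => ?_
    calc H i j ^ 2 / M i j ≤ H i j ^ 2 / ((1 - ζ) * b j) :=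
          div_le_div_of_nonneg_left (sq_nonneg _) (mul_pos h1ζ (hb j)) <| by
            linarith [(abs_le.1 (hM i j)).1]
      _ = (1 - ζ)⁻¹ * (H i j ^ 2 / b j) := by field_simp
  have hrow0 : 0 ≤ ∑ j, H i j ^ 2 / b j :=
    Finset.sum_nonneg fun j _ => div_nonneg (sq_nonneg _) (hb j).le
  calc v i * ∑ j, H i j ^ 2 / M i j ≤ v i * ((1 - ζ)⁻¹ * ∑ j, H i j ^ 2 / b j) :=
        mul_le_mul_of_nonneg_left hrow (hv0 i)
    _ ≤ (1 + ζ) * b i * ((1 - ζ)⁻¹ * ∑ j, H i j ^ 2 / b j) :=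
        mul_le_mul_of_nonneg_right (hv i) (mul_nonneg (inv_nonneg.2 h1ζ.le) hrow0)
    _ = (1 + ζ) / (1 - ζ) * (b i * ∑ j, H i j ^ 2 / b j) := by ring

theorem pathMean_score_sq_le_of_abs_sub_le (hb0 : ∀ i, 0 < b i) (hb : ∑ i, b i = 1)
    (hζ0 : 0 ≤ ζ) (hζ1 : ζ < 1) {M : α → α → ℝ} (hM : ∀ i j, |M i j - b j| ≤ ζ * b j)
    (hM1 : ∀ i, ∑ j, M i j = 1) {H : α → α → ℝ} (hH : ∀ i, ∑ j, H i j = 0) :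
    pathMean b M m (fun x => score M H x ^ 2) ≤
      m * ((1 + ζ) / (1 - ζ) * directionInfo b H) := by
  have hM0 : ∀ i j, 0 < M i j := fun i j => by
    linarith [(abs_le.1 (hM i j)).1, mul_pos (sub_pos.2 hζ1) (hb0 j)]
  refine pathMean_score_sq_le ⟨fun i => (hb0 i).le, hb⟩
    (fun i => ⟨fun j => (hM0 i j).le, hM1 i⟩) hM0 hH ?_ fun i => ?_
  · exact sum_mul_info_le_of_abs_sub_le hb0 hζ1 hM H (fun i => (hb0 i).le) fun i => by
      linarith [mul_nonneg hζ0 (hb0 i).le]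
  · exact sum_mul_info_le_of_abs_sub_le hb0 hζ1 hM H (fun l => (hM0 i l).le) fun l => by
      linarith [(abs_le.1 (hM i l)).2]

variable [Fintype ι] {H : ι → α → α → ℝ} {e : ℝ}

theorem van_trees_perturbedKernel [DecidableEq ι] (he : 0 < e) (hb0 : ∀ i, 0 < b i)
    (hb : ∑ i, b i = 1) (hH : ∀ a i, ∑ j, H a i j = 0) (hζ0 : 0 ≤ ζ) (hζ1 : ζ < 1) {a : ι}
    {θ : ι → ℝ} (hclose : ∀ t ∈ Icc (-e) e, ∀ i j,
      |perturbedKernel b H (Function.update θ a t) i j - b j| ≤ ζ * b j)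
    (T : (Fin (m + 1) → α) → ℝ) (i j : α) :
    H a i j ^ 2 / (m * ((1 + ζ) / (1 - ζ) * directionInfo b (H a)) + 10 / e ^ 2) ≤
      ∫ t, pathMean b (perturbedKernel b H (Function.update θ a t)) m
        (fun x => (T x - perturbedKernel b H (Function.update θ a t) i j) ^ 2)
        ∂quarticPrior e := by
  have hI := directionInfo_nonneg hb0 (H a)
  have h1ζ : 0 < 1 - ζ := sub_pos.2 hζ1
  obtain ⟨A, hA, hline⟩ : ∃ A : α → α → ℝ, (∀ i, ∑ j, A i j = 1) ∧
      ∀ t, perturbedKernel b H (Function.update θ a t) = lineKernel A (H a) t :=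
    ⟨_, sum_perturbedKernel hb hH _, perturbedKernel_update b H θ a⟩
  simp only [hline] at hclose ⊢
  refine van_trees he ⟨fun i => (hb0 i).le, hb⟩ hA (hH a) (fun t ht i j => ?_) (by positivity)
    (fun t ht => pathMean_score_sq_le_of_abs_sub_le hb0 hb hζ0 hζ1 (hclose t ht) (fun i => ?_)
      (hH a)) T _ _
  · linarith [(abs_le.1 (hclose t ht i j)).1, mul_pos h1ζ (hb0 j)]
  · simp only [lineKernel, Finset.sum_add_distrib, ← Finset.mul_sum, hA, hH, mul_zero, add_zero]

theorem sum_le_of_forall_perturbedKernel (he : 0 < e) (hb0 : ∀ i, 0 < b i)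
    (hb : ∑ i, b i = 1) (hH : ∀ a i, ∑ j, H a i j = 0) (hζ0 : 0 ≤ ζ) (hζ1 : ζ < 1)
    (hclose : ∀ θ : ι → ℝ, (∀ a, θ a ∈ Icc (-e) e) →
      ∀ i j, |perturbedKernel b H θ i j - b j| ≤ ζ * b j)
    (T : ι → (Fin (m + 1) → α) → ℝ) (row col : ι → α) {w : ι → ℝ} (hw : ∀ a, 0 ≤ w a) {B : ℝ}
    (hB : ∀ θ : ι → ℝ, (∀ a, θ a ∈ Icc (-e) e) →
      ∑ a, w a * pathMean b (perturbedKernel b H θ) m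
        (fun x => (T a x - perturbedKernel b H θ (row a) (col a)) ^ 2) ≤ B) :
    ∑ a, w a * (H a (row a) (col a) ^ 2 /
      (m * ((1 + ζ) / (1 - ζ) * directionInfo b (H a)) + 10 / e ^ 2)) ≤ B := by
  classical
  have := isProbabilityMeasure_quarticPrior he
  refine sum_le_of_forall_line (ae_quarticPrior_mem_Icc e) (fun a => ?_) hw (fun a θ hθ => ?_) hB
  · simp only [pathMean, pathWeight, perturbedKernel]
    fun_prop
  · refine van_trees_perturbedKernel he hb0 hb hH hζ0 hζ1 (fun t ht => hclose _ fun a' => ?_)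
      (T a) _ _
    rcases eq_or_ne a' a with rfl | hne
    · rwa [Function.update_self]
    · rw [Function.update_of_ne hne]
      exact hθ a'

end PerturbedKernel

section LocalMinimax

variable {k m : ℕ}

theorem MarkovModel.abs_stat_sub_le {P : MarkovModel k} {j : Fin k} {y r : ℝ}
    (h : ∀ i, |P.prob i j - y| ≤ r) : |P.stat j - y| ≤ r := by
  have hdiff : P.stat j - y = ∑ i, P.stat i * (P.prob i j - y) := by
    simp only [mul_sub, Finset.sum_sub_distrib, P.sum_stat_mul_prob, ← Finset.sum_mul,
      P.stat_mem.2, one_mul]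
  calc |P.stat j - y| ≤ ∑ i, |P.stat i * (P.prob i j - y)| :=
        hdiff ▸ Finset.abs_sum_le_sum_abs _ _
    _ ≤ ∑ i, P.stat i * r := Finset.sum_le_sum fun i _ => by
        rw [abs_mul, abs_of_nonneg (P.stat_mem.1 i)]
        exact mul_le_mul_of_nonneg_left (h i) (P.stat_mem.1 i)
    _ = r := by rw [← Finset.sum_mul, P.stat_mem.2, one_mul]

theorem sum_mul_pathMean_le_of_sum_stateRisk_le {L : (Fin k → ℝ) → (Fin k → ℝ) → EReal}
    {P : MarkovModel k} {E : Estimator (m + 1) k} {T : (Fin k → ℝ) → Fin k → ℝ} {b w : Fin k → ℝ}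
    {a B : ℝ} (hT : ∀ i, ∀ q ∈ stdSimplex ℝ (Fin k),
      ((a * ∑ j, (P.prob i j - T q j) ^ 2 / b j : ℝ) : EReal) ≤ L (P.prob i) q)
    (hw : ∀ i, 0 ≤ w i) (hB : ∑ i, (w i : EReal) * stateRisk L P E i ≤ B) :
    ∑ z : Fin k × Fin k, a * (w z.1 / b z.2) * pathMean P.init P.prob m
      (fun x => (T ((E x).1 z.1) z.2 - P.prob z.1 z.2) ^ 2) ≤ B := by
  have hrow : ∀ i, ((pathMean P.init P.prob m fun x =>
      a * ∑ j, (P.prob i j - T ((E x).1 i) j) ^ 2 / b j : ℝ) : EReal) ≤ stateRisk L P E i :=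
    fun i => pathMean_le_stateRisk fun x => hT i _ (rowStochastic_row_mem_stdSimplex (E x) i)
  have hsum : ((∑ i, w i * pathMean P.init P.prob m fun x =>
      a * ∑ j, (P.prob i j - T ((E x).1 i) j) ^ 2 / b j : ℝ) : EReal) ≤ B := by
    refine le_trans ?_ hB
    rw [coe_sum_eReal]
    refine Finset.sum_le_sum fun i _ => ?_
    rw [EReal.coe_mul]
    exact mul_le_mul_of_nonneg_left (hrow i) (EReal.coe_nonneg.2 (hw i))
  refine le_of_eq_of_le ?_ (EReal.coe_le_coe_iff.1 hsum)
  rw [Fintype.sum_prod_type]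
  refine Finset.sum_congr rfl fun i _ => ?_
  simp only [pathMean_const_mul, pathMean_sum, Finset.mul_sum, div_eq_inv_mul, sub_sq_comm (T _ _)]
  exact Finset.sum_congr rfl fun j _ => by ring

/-- The class `S` contains all small perturbations, in the directions `H`, of the chain that draws
independent samples from `b`. The direction `H (i, j)` serves to bound from below the error in the
entry `(i, j)` of the transition matrix. -/
structure IsPerturbationFamily (S : Set (MarkovModel k)) (b : Fin k → ℝ)
    (H : Fin k × Fin k → Fin k → Fin k → ℝ) : Prop where
  pos : ∀ i, 0 < b i
  sum_eq_one : ∑ i, b i = 1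
  sum_row : ∀ a i, ∑ j, H a i j = 0
  exists_mem : ∀ᶠ θ in 𝓝 0, ∃ P ∈ S, P.init = b ∧ P.prob = perturbedKernel b H θ

/-- The sum over the row `i` of the local lower bounds for the squared errors of the entries, each
relative to the entry and multiplied by the sample size. -/
def rowBound (b : Fin k → ℝ) (H : Fin k × Fin k → Fin k → Fin k → ℝ) (i : Fin k) : ℝ :=
  ∑ j, H (i, j) i j ^ 2 / (b j * directionInfo b (H (i, j)))

theorem exists_box_of_eventually_nhds_zero {ι : Type*} [Finite ι] {p : (ι → ℝ) → Prop}
    (h : ∀ᶠ θ in 𝓝 0, p θ) : ∃ e : ℝ, 0 < e ∧ ∀ θ : ι → ℝ, (∀ a, θ a ∈ Icc (-e) e) → p θ := by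
  cases nonempty_fintype ι
  obtain ⟨e, he, hball⟩ := Metric.nhds_basis_closedBall.eventually_iff.1 h
  refine ⟨e, he, fun θ hθ => hball ?_⟩
  rw [mem_closedBall_zero_iff, pi_norm_le_iff_of_nonneg he.le]
  exact fun a => abs_le.2 (hθ a)

variable {f : ℝ → ℝ} {c A : ℝ} {S : Set (MarkovModel k)} {b : Fin k → ℝ}
  {H : Fin k × Fin k → Fin k → Fin k → ℝ}

theorem HasConvexExpansion.exists_local_minimax (hf : HasConvexExpansion f c A)
    (hS : IsPerturbationFamily S b H) {ζ : ℝ} (hζ0 : 0 < ζ) (hζ1 : ζ < 1) :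
    ∃ D : ℝ, 0 < D ∧ ∀ (m : ℕ) (E : Estimator (m + 1) k) (w : Fin k → ℝ), (∀ i, 0 ≤ w i) →
      ∀ B : ℝ, (∀ P ∈ S, (∀ j, |P.stat j - b j| ≤ ζ * b j) →
        ∑ i, (w i : EReal) * stateRisk (fDiv f) P E i ≤ B) →
      ∑ z, (1 - ζ) * (A / 2) * (w z.1 / b z.2) * (H z z.1 z.2 ^ 2 /
        (m * ((1 + ζ) / (1 - ζ) * directionInfo b (H z)) + D)) ≤ B := by
  have hA := hf.pos
  obtain ⟨β, hβ, hβb⟩ := Pi.exists_forall_pos_add_lt (x := 0) (y := b) hS.pos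
  obtain ⟨ε, hε, T, hT⟩ := hf.exists_truncation hβ (fun j => by simpa using (hβb j).le) hζ0 hζ1
  have hclose := eventually_abs_perturbedKernel_sub_le b H (lt_min (mul_pos hζ0 hβ) hε)
  obtain ⟨e, he, hbox⟩ := exists_box_of_eventually_nhds_zero (hclose.and hS.exists_mem)
  have hζb : ∀ θ : Fin k × Fin k → ℝ, (∀ a, θ a ∈ Icc (-e) e) →
      ∀ i j, |perturbedKernel b H θ i j - b j| ≤ ζ * b j := fun θ hθ i j =>
    ((hbox θ hθ).1 i j).trans <| (min_le_left _ _).trans <|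
      mul_le_mul_of_nonneg_left (by simpa using (hβb j).le) hζ0.le
  refine ⟨10 / e ^ 2, by positivity, fun m E w hw B hB => ?_⟩
  refine sum_le_of_forall_perturbedKernel (T := fun z x => T ((E x).1 z.1) z.2) (row := Prod.fst)
    (col := Prod.snd) (w := fun z => (1 - ζ) * (A / 2) * (w z.1 / b z.2)) he hS.pos hS.sum_eq_one
    hS.sum_row hζ0.le hζ1 hζb (fun z => ?_) fun θ hθ => ?_
  · exact mul_nonneg (mul_nonneg (sub_nonneg.2 hζ1.le) (by positivity))
      (div_nonneg (hw _) (hS.pos _).le)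
  · obtain ⟨hθclose, P, hPS, hPinit, hPprob⟩ := hbox θ hθ
    rw [← hPprob] at hθclose
    have hPb : ∀ i j, |P.prob i j - b j| ≤ ζ * b j := hPprob ▸ hζb θ hθ
    have hPpos : ∀ i j, 0 < P.prob i j := fun i j => by
      linarith [(abs_le.1 (hPb i j)).1, mul_pos (sub_pos.2 hζ1) (hS.pos j)]
    have hmean := sum_mul_pathMean_le_of_sum_stateRisk_le (fun i q hq =>
      hT _ q (P.prob_mem_stdSimplex i) hq (hPpos i) fun j => (hθclose i j).trans (min_le_right _ _))
      hw (hB P hPS fun j => P.abs_stat_sub_le fun i => hPb i j)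
    rwa [hPinit, hPprob] at hmean

theorem eventually_div_le_inv_add {a K D : ℝ} (hK : 0 < K) (hD : 0 ≤ D) (haK : a * K < 1) :
    ∀ᶠ n : ℕ in atTop, a / n ≤ (n * K + D)⁻¹ := by
  have hlarge : ∀ᶠ n : ℕ in atTop, a * D ≤ n * (1 - a * K) :=
    (tendsto_natCast_atTop_atTop.atTop_mul_const (sub_pos.2 haK)).eventually_ge_atTop _
  filter_upwards [hlarge, eventually_gt_atTop 0] with n hn hn0
  have : (0 : ℝ) < n := by exact_mod_cast hn0
  rw [inv_eq_one_div, div_le_div_iff₀ (by positivity) (by positivity)]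
  linarith

theorem eventually_mul_sq_div_le {ζ h I D : ℝ} (hζ0 : 0 < ζ) (hζ1 : ζ < 1)
    (hI : h ≠ 0 → 0 < I) (hD : 0 ≤ D) :
    ∀ᶠ n : ℕ in atTop, (1 - 4 * ζ) / n * (h ^ 2 / I) ≤
      (1 - ζ) * (h ^ 2 / (n * ((1 + ζ) / (1 - ζ) * I) + D)) := by
  rcases eq_or_ne h 0 with rfl | hh
  · simp
  have hI := hI hh
  have h1ζ : 0 < 1 - ζ := sub_pos.2 hζ1
  have hsmall : (1 - 4 * ζ) / ((1 - ζ) * I) * ((1 + ζ) / (1 - ζ) * I) < 1 := by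
    have hcancel : (1 - 4 * ζ) / ((1 - ζ) * I) * ((1 + ζ) / (1 - ζ) * I) =
        (1 - 4 * ζ) * (1 + ζ) / (1 - ζ) ^ 2 := by field_simp
    rw [hcancel, div_lt_one (by positivity)]
    nlinarith
  filter_upwards [eventually_div_le_inv_add (by positivity) hD hsmall] with n hn
  calc (1 - 4 * ζ) / n * (h ^ 2 / I)
      = (1 - ζ) * h ^ 2 * ((1 - 4 * ζ) / ((1 - ζ) * I) / n) := by field_simp
    _ ≤ (1 - ζ) * h ^ 2 * (n * ((1 + ζ) / (1 - ζ) * I) + D)⁻¹ := by gcongr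
    _ = _ := by ring

theorem HasConvexExpansion.eventually_local_minimax (hf : HasConvexExpansion f c A)
    (hS : IsPerturbationFamily S b H) {η : ℝ} (hη0 : 0 < η) (hη1 : η < 1) :
    ∀ᶠ n : ℕ in atTop, ∀ E : Estimator n k, ∀ w : Fin k → ℝ, (∀ i, 0 ≤ w i) → ∀ B : ℝ,
      (∀ P ∈ S, (∀ j, |P.stat j - b j| ≤ η * b j) →
        ∑ i, (w i : EReal) * stateRisk (fDiv f) P E i ≤ B) →
      (1 - η) * (A / (2 * n)) * ∑ i, w i * rowBound b H i ≤ B := by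
  have hA := hf.pos
  obtain ⟨ζ, rfl⟩ : ∃ ζ, η = 4 * ζ := ⟨η / 4, by ring⟩
  have hζ0 : 0 < ζ := by linarith
  have hζ1 : ζ < 1 := by linarith
  obtain ⟨D, hD, hbound⟩ := hf.exists_local_minimax hS hζ0 hζ1
  have hcoord : ∀ᶠ n : ℕ in atTop, ∀ z : Fin k × Fin k,
      (1 - 4 * ζ) / n * (H z z.1 z.2 ^ 2 / directionInfo b (H z)) ≤ (1 - ζ) *
        (H z z.1 z.2 ^ 2 / (n * ((1 + ζ) / (1 - ζ) * directionInfo b (H z)) + D)) :=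
    eventually_all.2 fun z => eventually_mul_sq_div_le hζ0 hζ1 (directionInfo_pos hS.pos) hD.le
  filter_upwards [hcoord, eventually_gt_atTop 0] with n hn hn0 E w hw B hB
  obtain ⟨m, rfl⟩ := Nat.exists_eq_add_one.2 hn0
  refine le_trans ?_ (hbound m E w hw B fun P hPS hP => hB P hPS fun j => (hP j).trans ?_)
  · simp only [rowBound, Finset.mul_sum, Fintype.sum_prod_type]
    refine Finset.sum_le_sum fun i _ => Finset.sum_le_sum fun j _ => ?_
    have hI := directionInfo_nonneg hS.pos (H (i, j))
    have hwb : 0 ≤ A / 2 * (w i / b j) :=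
      mul_nonneg (by positivity) (div_nonneg (hw i) (hS.pos j).le)
    have : 0 < 1 - ζ := sub_pos.2 hζ1
    calc (1 - 4 * ζ) * (A / (2 * ((m + 1 : ℕ) : ℝ))) *
          (w i * (H (i, j) i j ^ 2 / (b j * directionInfo b (H (i, j)))))
        = A / 2 * (w i / b j) *
          ((1 - 4 * ζ) / (m + 1 : ℕ) * (H (i, j) i j ^ 2 / directionInfo b (H (i, j)))) := by
          simp only [div_eq_mul_inv, mul_inv]
          ring
      _ ≤ A / 2 * (w i / b j) * ((1 - ζ) * (H (i, j) i j ^ 2 /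
          (m * ((1 + ζ) / (1 - ζ) * directionInfo b (H (i, j))) + D))) := by
          refine mul_le_mul_of_nonneg_left ((hn (i, j)).trans ?_) hwb
          gcongr
          exact m.le_succ
      _ = _ := by ring
  · exact mul_le_mul_of_nonneg_right (by linarith) (hS.pos j).le

end LocalMinimax

section LowerAsymptotics

theorem AsympLE.of_forall_mul_le {a : ℕ → ℝ} {b : ℕ → EReal} (ha : ∀ᶠ n in atTop, 0 ≤ a n)
    (h : ∀ θ : ℝ, 0 < θ → θ < 1 → ∀ᶠ n in atTop, ((θ * a n : ℝ) : EReal) ≤ b n) :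
    AsympLE (fun n => (a n : EReal)) b := by
  refine ⟨fun n => max 0 (a n / (b n).toReal - 1), ?_, ?_⟩
  · refine tendsto_order.2 ⟨fun e he => .of_forall fun n => he.trans_le (le_max_left _ _),
      fun e he => ?_⟩
    filter_upwards [ha, h (1 + e / 2)⁻¹ (by positivity) (inv_lt_one_of_one_lt₀ (by linarith))]
      with n han hbn
    refine max_lt he (sub_lt_iff_lt_add'.2 (lt_of_le_of_lt ?_ (by linarith : 1 + e / 2 < 1 + e)))
    rcases eq_or_ne (b n) ⊤ with htop | htop
    · rw [htop, EReal.toReal_top, div_zero]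
      positivity
    · have hle := EReal.toReal_le_toReal hbn (EReal.coe_ne_bot _) htop
      rw [EReal.toReal_coe, inv_mul_le_iff₀ (by positivity)] at hle
      have hbn0 : 0 ≤ b n := hbn.trans' (EReal.coe_nonneg.2 (by positivity))
      exact div_le_of_le_mul₀ (EReal.toReal_nonneg hbn0) (by positivity) hle
  · filter_upwards [ha, h (1 / 2) (by norm_num) (by norm_num)] with n han hbn
    induction hy : b n using EReal.rec with
    | bot => exact absurd (le_bot_iff.1 (hy ▸ hbn)) (EReal.coe_ne_bot _)
    | top => rw [EReal.top_mul_coe_of_pos (by positivity)]; exact le_top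
    | coe y =>
      rw [hy, EReal.coe_le_coe_iff] at hbn
      rw [EReal.toReal_coe, ← EReal.coe_mul, EReal.coe_le_coe_iff]
      rcases (show 0 ≤ y by linarith).eq_or_lt with rfl | hy0
      · linarith
      · rw [← div_le_iff₀' hy0, ← sub_le_iff_le_add']
        exact le_max_right _ _

theorem AsympLE.of_le {a b : ℕ → EReal} (h : ∀ n, a n ≤ b n) : AsympLE a b :=
  ⟨fun _ => 0, tendsto_const_nhds, .of_forall fun n => by simpa using h n⟩

theorem AsympLE.mono_left {a a' b : ℕ → EReal} (h : AsympLE a' b) (ha : ∀ n, a n ≤ a' n) :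
    AsympLE a b := by
  obtain ⟨o, ho, hle⟩ := h
  exact ⟨o, ho, hle.mono fun n hn => (ha n).trans hn⟩

theorem AsympLE.one_sub_mul {x : ℕ → ℝ} {b : ℕ → EReal} {ρ : ℝ} (hρ0 : 0 ≤ ρ) (hρ1 : ρ ≤ 1)
    (h : AsympLE (fun n => ((max (x n) 0 : ℝ) : EReal)) b) :
    AsympLE (fun n => (((1 - ρ) * x n : ℝ) : EReal)) b :=
  h.mono_left fun _ => EReal.coe_le_coe <|
    (mul_le_mul_of_nonneg_left (le_max_left _ 0) (sub_nonneg.2 hρ1)).trans <|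
      mul_le_of_le_one_left (le_max_right _ _) (sub_le_self _ hρ0)

variable {k n : ℕ} {f : ℝ → ℝ} {c A : ℝ} {S : Set (MarkovModel k)}

theorem MarkovModel.pathProb_nonneg (P : MarkovModel k) (x : Fin n → Fin k) :
    0 ≤ P.pathProb n x := by
  cases n with
  | zero => exact zero_le_one
  | succ m =>
    exact mul_nonneg (P.init_mem.1 _) (Finset.prod_nonneg fun t _ => P.trans_mem.1 _ _)

section Nonneg

variable {P : MarkovModel k}

theorem HasConvexExpansion.stateRisk_nonneg (hf : HasConvexExpansion f c A)
    (hP : ∀ i j, 0 < P.prob i j) (E : Estimator n k) (i : Fin k) :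
    0 ≤ stateRisk (fDiv f) P E i :=
  Finset.sum_nonneg fun x _ => mul_nonneg (EReal.coe_nonneg.2 (P.pathProb_nonneg x)) <|
    have hE := rowStochastic_row_mem_stdSimplex (E x) i
    hf.fDiv_nonneg ((P.prob_mem_stdSimplex i).2.trans hE.2.symm) (hP i) hE.1

theorem HasConvexExpansion.weightedRisk_nonneg (hf : HasConvexExpansion f c A)
    (hP : ∀ i j, 0 < P.prob i j) (E : Estimator n k) : 0 ≤ weightedRisk (fDiv f) P E :=
  Finset.sum_nonneg fun i _ => mul_nonneg (EReal.coe_nonneg.2 (P.stat_mem.1 i))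
    (hf.stateRisk_nonneg hP E i)

theorem HasConvexExpansion.worstRisk_nonneg [Nonempty (Fin k)] (hf : HasConvexExpansion f c A)
    (hP : ∀ i j, 0 < P.prob i j) (E : Estimator n k) : 0 ≤ worstRisk (fDiv f) P E :=
  le_iSup_of_le (Classical.arbitrary _) (hf.stateRisk_nonneg hP E _)

theorem HasConvexExpansion.minimaxWeighted_nonneg (hf : HasConvexExpansion f c A) (hPS : P ∈ S)
    (hP : ∀ i j, 0 < P.prob i j) : 0 ≤ minimaxWeighted (fDiv f) S n :=
  le_iInf fun E => le_iSup₂_of_le P hPS (hf.weightedRisk_nonneg hP E)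

theorem HasConvexExpansion.minimaxWorst_nonneg [Nonempty (Fin k)] (hf : HasConvexExpansion f c A)
    (hPS : P ∈ S) (hP : ∀ i j, 0 < P.prob i j) : 0 ≤ minimaxWorst (fDiv f) S n :=
  le_iInf fun E => le_iSup₂_of_le P hPS (hf.worstRisk_nonneg hP E)

end Nonneg

theorem coe_le_of_forall_le_coe {x : ℝ} {V : EReal} (hV : V ≠ ⊥) (h : ∀ B : ℝ, V ≤ B → x ≤ B) :
    (x : EReal) ≤ V := by
  induction V using EReal.rec with
  | bot => exact absurd rfl hV
  | coe B => exact EReal.coe_le_coe (h B le_rfl)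
  | top => exact le_top

variable {b : Fin k → ℝ} {H : Fin k × Fin k → Fin k → Fin k → ℝ}

theorem rowBound_nonneg (hb : ∀ j, 0 < b j) (i : Fin k) : 0 ≤ rowBound b H i :=
  Finset.sum_nonneg fun j _ =>
    div_nonneg (sq_nonneg _) (mul_nonneg (hb j).le (directionInfo_nonneg hb _))

theorem HasConvexExpansion.eventually_le_minimaxWeighted (hf : HasConvexExpansion f c A)
    (hS0 : ∀ P ∈ S, ∀ i j, 0 < P.prob i j) (hS : IsPerturbationFamily S b H) {η : ℝ}
    (hη0 : 0 < η) (hη1 : η < 1) :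
    ∀ᶠ n : ℕ in atTop, (((1 - η) ^ 2 * (A / (2 * n) * ∑ i, b i * rowBound b H i) : ℝ) : EReal) ≤
      minimaxWeighted (fDiv f) S n := by
  obtain ⟨P₀, hP₀, -⟩ := hS.exists_mem.self_of_nhds
  filter_upwards [hf.eventually_local_minimax hS hη0 hη1] with n hn
  refine le_iInf fun E => coe_le_of_forall_le_coe (ne_bot_of_le_ne_bot EReal.zero_ne_bot
    (le_iSup₂_of_le P₀ hP₀ (hf.weightedRisk_nonneg (hS0 P₀ hP₀) E))) fun B hB => ?_
  refine le_of_eq_of_le ?_ (hn E (fun i => (1 - η) * b i)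
    (fun i => mul_nonneg (sub_nonneg.2 hη1.le) (hS.pos i).le) B fun P hP hPb => ?_)
  · simp only [mul_assoc, ← Finset.mul_sum]
    ring
  · refine le_trans (Finset.sum_le_sum fun i _ => ?_) ((le_iSup₂_of_le P hP le_rfl).trans hB)
    refine mul_le_mul_of_nonneg_right (EReal.coe_le_coe ?_) (hf.stateRisk_nonneg (hS0 P hP) E i)
    linarith [(abs_le.1 (hPb i)).1]

theorem HasConvexExpansion.eventually_le_minimaxWorst (hf : HasConvexExpansion f c A)
    (hS0 : ∀ P ∈ S, ∀ i j, 0 < P.prob i j) (hS : IsPerturbationFamily S b H) {η : ℝ}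
    (hη0 : 0 < η) (hη1 : η < 1) (i : Fin k) :
    ∀ᶠ n : ℕ in atTop, (((1 - η) * (A / (2 * n) * rowBound b H i) : ℝ) : EReal) ≤
      minimaxWorst (fDiv f) S n := by
  have : Nonempty (Fin k) := ⟨i⟩
  obtain ⟨P₀, hP₀, -⟩ := hS.exists_mem.self_of_nhds
  filter_upwards [hf.eventually_local_minimax hS hη0 hη1] with n hn
  refine le_iInf fun E => coe_le_of_forall_le_coe (ne_bot_of_le_ne_bot EReal.zero_ne_bot
    (le_iSup₂_of_le P₀ hP₀ (hf.worstRisk_nonneg (hS0 P₀ hP₀) E))) fun B hB => ?_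
  have hsingle : (0 : Fin k → ℝ) ≤ Pi.single i 1 := Pi.single_nonneg.2 zero_le_one
  refine le_of_eq_of_le ?_ (hn E (Pi.single i 1) hsingle B fun P hP _ => ?_)
  · rw [Finset.sum_eq_single_of_mem i (Finset.mem_univ i) fun j _ hj => by simp [hj],
      Pi.single_eq_same]
    ring
  · rw [Finset.sum_eq_single_of_mem i (Finset.mem_univ i) fun j _ hj => by simp [hj],
      Pi.single_eq_same, EReal.coe_one, one_mul]
    exact (le_iSup_of_le i le_rfl).trans ((le_iSup₂_of_le P hP le_rfl).trans hB)

theorem HasConvexExpansion.asympLE_minimaxWeighted (hf : HasConvexExpansion f c A)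
    (hS0 : ∀ P ∈ S, ∀ i j, 0 < P.prob i j) (hS : IsPerturbationFamily S b H) :
    AsympLE (fun n => ((A / (2 * n) * ∑ i, b i * rowBound b H i : ℝ) : EReal))
      (minimaxWeighted (fDiv f) S) := by
  have hA := hf.pos
  have hsum : 0 ≤ ∑ i, b i * rowBound b H i :=
    Finset.sum_nonneg fun i _ => mul_nonneg (hS.pos i).le (rowBound_nonneg hS.pos i)
  refine .of_forall_mul_le (.of_forall fun n => by positivity) fun θ hθ0 hθ1 => ?_
  have hsqrt : √θ < 1 := (Real.sqrt_lt' one_pos).2 (by linarith)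
  simpa only [sub_sub_cancel, Real.sq_sqrt hθ0.le] using
    hf.eventually_le_minimaxWeighted hS0 hS (η := 1 - √θ) (sub_pos.2 hsqrt)
      (sub_lt_self _ (Real.sqrt_pos.2 hθ0))

theorem HasConvexExpansion.asympLE_minimaxWorst (hf : HasConvexExpansion f c A)
    (hS0 : ∀ P ∈ S, ∀ i j, 0 < P.prob i j) (hS : IsPerturbationFamily S b H) (i : Fin k) :
    AsympLE (fun n => ((A / (2 * n) * rowBound b H i : ℝ) : EReal))
      (minimaxWorst (fDiv f) S) := by
  have hA := hf.pos
  have hrow := rowBound_nonneg (H := H) hS.pos i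
  refine .of_forall_mul_le (.of_forall fun n => by positivity) fun θ hθ0 hθ1 => ?_
  simpa only [sub_sub_cancel] using
    hf.eventually_le_minimaxWorst hS0 hS (η := 1 - θ) (sub_pos.2 hθ1) (sub_lt_self _ hθ0) i

end LowerAsymptotics

section PerturbationFamilies

section StationaryDistribution

variable {n : Type*} [Fintype n] [DecidableEq n] {M : Matrix n n ℝ}

theorem vecMul_abs_eq_of_vecMul_eq (hM : M ∈ Matrix.rowStochastic ℝ n) {v : n → ℝ}
    (hv : Matrix.vecMul v M = v) : Matrix.vecMul |v| M = |v| := by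
  obtain ⟨hM0, hM1⟩ := Matrix.mem_rowStochastic_iff_sum.1 hM
  have hle : ∀ j ∈ Finset.univ, |v j| ≤ ∑ i, |v i| * M i j := fun j _ => by
    calc |v j| = |∑ i, v i * M i j| := congrArg abs (congrFun hv j).symm
      _ ≤ ∑ i, |v i * M i j| := Finset.abs_sum_le_sum_abs _ _
      _ = ∑ i, |v i| * M i j := Finset.sum_congr rfl fun i _ => by
          rw [abs_mul, abs_of_nonneg (hM0 i j)]
  have hsum : ∑ j, |v j| = ∑ j, ∑ i, |v i| * M i j := by
    rw [Finset.sum_comm]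
    simp only [← Finset.mul_sum, hM1, mul_one]
  exact funext fun j => ((Finset.sum_eq_sum_iff_of_le hle).1 hsum j (Finset.mem_univ j)).symm

theorem exists_vecMul_eq_of_mem_rowStochastic [Nonempty n] (hM : M ∈ Matrix.rowStochastic ℝ n) :
    ∃ π ∈ stdSimplex ℝ n, Matrix.vecMul π M = π := by
  have hdet : (M - 1).det = 0 := Matrix.exists_mulVec_eq_zero_iff.1 ⟨1, one_ne_zero, by
    rw [Matrix.sub_mulVec, Matrix.one_mulVec, Matrix.one_vecMul_of_mem_rowStochastic hM, sub_self]⟩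
  obtain ⟨v, hv0, hv⟩ := Matrix.exists_vecMul_eq_zero_iff.2 hdet
  rw [Matrix.vecMul_sub, Matrix.vecMul_one, sub_eq_zero] at hv
  have hpos : 0 < ∑ j, |v| j := by
    obtain ⟨i, hi⟩ := Function.ne_iff.1 hv0
    exact Finset.sum_pos' (fun _ _ => abs_nonneg _) ⟨i, Finset.mem_univ _, abs_pos.2 hi⟩
  refine ⟨(∑ j, |v| j)⁻¹ • |v|, ⟨fun j => ?_, ?_⟩, ?_⟩
  · exact mul_nonneg (inv_nonneg.2 hpos.le) (abs_nonneg _)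
  · simp only [Pi.smul_apply, smul_eq_mul, ← Finset.mul_sum]
    exact inv_mul_cancel₀ hpos.ne'
  · rw [Matrix.smul_vecMul, vecMul_abs_eq_of_vecMul_eq hM hv]

end StationaryDistribution

section CenteredUnit

variable {α : Type*} [DecidableEq α] {s : Finset α} {j l : α}

/-- The unit vector at `j` minus the uniform distribution on `s`, and zero when `j ∉ s`: the
direction in which one entry of a row is estimated while the entries outside `s` stay fixed. -/
def centeredUnit (s : Finset α) (j l : α) : ℝ :=
  if j ∈ s ∧ l ∈ s then (if l = j then 1 else 0) - 1 / s.card else 0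

theorem centeredUnit_self (hj : j ∈ s) : centeredUnit s j j = 1 - 1 / s.card := by
  simp [centeredUnit, hj]

theorem centeredUnit_of_notMem_left (hj : j ∉ s) : centeredUnit s j l = 0 :=
  if_neg fun h => hj h.1

theorem centeredUnit_of_notMem_right (hl : l ∉ s) : centeredUnit s j l = 0 :=
  if_neg fun h => hl h.2

variable [Fintype α]

theorem sum_centeredUnit (s : Finset α) (j : α) : ∑ l, centeredUnit s j l = 0 := by
  by_cases hj : j ∈ s
  · have hs : (s.card : ℝ) ≠ 0 := Nat.cast_ne_zero.2 (Finset.card_ne_zero_of_mem hj)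
    simp [centeredUnit, hj, Finset.sum_ite_mem, hs]
  · exact Finset.sum_eq_zero fun l _ => centeredUnit_of_notMem_left hj

theorem sum_centeredUnit_sq (hj : j ∈ s) : ∑ l, centeredUnit s j l ^ 2 = 1 - 1 / s.card := by
  have hs : (s.card : ℝ) ≠ 0 := Nat.cast_ne_zero.2 (Finset.card_ne_zero_of_mem hj)
  have hsq : ∀ l, centeredUnit s j l ^ 2 =
      if l ∈ s then (if l = j then 1 - 2 / (s.card : ℝ) else 0) + (1 / s.card) ^ 2 else 0 :=
    fun l => by
      simp only [centeredUnit, hj, true_and]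
      split_ifs <;> ring
  simp only [hsq, Finset.sum_ite_mem, Finset.univ_inter, Finset.sum_add_distrib,
    Finset.sum_ite_eq', hj, if_true, Finset.sum_const, nsmul_eq_mul]
  field_simp
  ring

theorem sum_centeredUnit_sq_div (hj : j ∈ s) {b : α → ℝ} {c : ℝ} (hb : ∀ l ∈ s, b l = c) :
    ∑ l, centeredUnit s j l ^ 2 / b l = (1 - 1 / s.card) / c := by
  rw [← sum_centeredUnit_sq hj, Finset.sum_div]
  refine Finset.sum_congr rfl fun l _ => ?_
  by_cases hl : l ∈ s
  · rw [hb l hl]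
  · simp [centeredUnit_of_notMem_right hl]

end CenteredUnit

section ProductDirection

variable {α : Type*} [DecidableEq α]

/-- The direction of rank one for the entry `a`, with weight `u a.1 i` on the row `i`, in which the
columns outside `s` stay fixed. -/
def productDirection (u : α → α → ℝ) (s : Finset α) (a : α × α) (i j : α) : ℝ :=
  u a.1 i * centeredUnit s a.2 j

variable [Fintype α] {s : Finset α} {b : α → ℝ} {c : ℝ} {u : α → α → ℝ}

theorem sum_productDirection (u : α → α → ℝ) (s : Finset α) (a : α × α) (i : α) :
    ∑ j, productDirection u s a i j = 0 := by
  simp only [productDirection, ← Finset.mul_sum, sum_centeredUnit, mul_zero]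

theorem perturbedKernel_productDirection_of_notMem {j : α} (hj : j ∉ s) (θ : α × α → ℝ) (i : α) :
    perturbedKernel b (productDirection u s) θ i j = b j := by
  simp [perturbedKernel, productDirection, centeredUnit_of_notMem_right hj]

theorem directionInfo_productDirection {a : α × α} (ha : a.2 ∈ s) (hb : ∀ j ∈ s, b j = c) :
    directionInfo b (productDirection u s a) =
      (∑ i, b i * u a.1 i ^ 2) * ((1 - 1 / s.card) / c) := by
  rw [← sum_centeredUnit_sq_div ha hb, Finset.sum_mul]
  refine Finset.sum_congr rfl fun i _ => ?_
  simp only [productDirection, mul_pow, mul_div_assoc, ← Finset.mul_sum]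
  ring

end ProductDirection

variable {k : ℕ} {δ ρ : ℝ}

theorem rowBound_productDirection {s : Finset (Fin k)} (hs : 1 < s.card) {b : Fin k → ℝ} {c : ℝ}
    (hc : 0 < c) (hb : ∀ j ∈ s, b j = c) (u : Fin k → Fin k → ℝ) (i : Fin k) :
    rowBound b (productDirection u s) i =
      ((s.card : ℝ) - 1) * (u i i ^ 2 / ∑ l, b l * u i l ^ 2) := by
  have hs1 : (1 : ℝ) < s.card := by exact_mod_cast hs
  have hterm : ∀ j, productDirection u s (i, j) i j ^ 2 /
      (b j * directionInfo b (productDirection u s (i, j))) =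
      if j ∈ s then (1 - 1 / s.card) * (u i i ^ 2 / ∑ l, b l * u i l ^ 2) else 0 := fun j => by
    split_ifs with hj
    · rw [directionInfo_productDirection hj hb, hb j hj, productDirection, centeredUnit_self hj]
      have : 1 - 1 / (s.card : ℝ) ≠ 0 := (sub_pos.2 ((div_lt_one (by linarith)).2 hs1)).ne'
      field_simp
    · simp [productDirection, centeredUnit_of_notMem_left hj]
  simp only [rowBound, hterm, Finset.sum_ite_mem, Finset.univ_inter, Finset.sum_const,
    nsmul_eq_mul]
  field_simp

theorem isPerturbationFamily_uniform (hk : 0 < k) (hδ : 0 < δ) (hδk : δ < 1 / (k : ℝ)) :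
    IsPerturbationFamily (chainClass k δ (1 / k)) (fun _ => 1 / k)
      (productDirection (centeredUnit Finset.univ) Finset.univ) := by
  have hk0 : (0 : ℝ) < k := Nat.cast_pos.2 hk
  have hsum : ∑ _ : Fin k, 1 / (k : ℝ) = 1 := by simp [hk0.ne']
  have hmem : (fun _ : Fin k => 1 / (k : ℝ)) ∈ stdSimplex ℝ (Fin k) :=
    ⟨fun _ => by positivity, hsum⟩
  set H := productDirection (centeredUnit (Finset.univ : Finset (Fin k))) Finset.univ with hH
  refine ⟨fun _ => by positivity, hsum, sum_productDirection _ _, ?_⟩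
  filter_upwards [eventually_abs_perturbedKernel_sub_le (fun _ : Fin k => 1 / (k : ℝ)) H
    (sub_pos.2 hδk)] with θ hθ
  have hδM : ∀ i j, δ ≤ perturbedKernel (fun _ => 1 / (k : ℝ)) H θ i j :=
    fun i j => by linarith [(abs_le.1 (hθ i j)).1]
  have hcol : ∀ j, ∑ i, perturbedKernel (fun _ => 1 / (k : ℝ)) H θ i j = 1 := fun j => by
    simp only [perturbedKernel, Finset.sum_add_distrib, hsum]
    rw [Finset.sum_comm]
    simp only [hH, productDirection, ← Finset.mul_sum, ← Finset.sum_mul, sum_centeredUnit,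
      zero_mul, mul_zero, Finset.sum_const_zero, add_zero]
  have hrows := sum_perturbedKernel hsum (sum_productDirection _ _ : ∀ a i, ∑ j, H a i j = 0) θ
  refine ⟨⟨_, Matrix.of (perturbedKernel (fun _ => 1 / (k : ℝ)) H θ), fun _ => 1 / k, hmem,
    Matrix.mem_rowStochastic_iff_sum.2 ⟨fun i j => hδ.le.trans (hδM i j), hrows⟩, hmem,
    funext fun j => ?_⟩, ⟨hδM, ⟨⟨0, hk⟩, rfl⟩, ?_⟩, rfl, rfl⟩
  · change ∑ i, 1 / (k : ℝ) * perturbedKernel (fun _ => 1 / (k : ℝ)) H θ i j = 1 / k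
    rw [← Finset.mul_sum, hcol, mul_one]
  · rintro _ ⟨i, rfl⟩
    exact le_rfl

theorem rowBound_uniform (hk : 2 ≤ k) (i : Fin k) :
    rowBound (fun _ => 1 / (k : ℝ))
      (productDirection (centeredUnit Finset.univ) Finset.univ) i = ((k : ℝ) - 1) ^ 2 := by
  have hk2 : (2 : ℝ) ≤ k := by exact_mod_cast hk
  have hcard : (Finset.univ : Finset (Fin k)).card = k := Finset.card_fin k
  rw [rowBound_productDirection (by omega) (by positivity) fun _ _ => rfl, ← Finset.mul_sum,
    sum_centeredUnit_sq (Finset.mem_univ i), centeredUnit_self (Finset.mem_univ i), hcard]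
  have : 1 - 1 / (k : ℝ) ≠ 0 := (sub_pos.2 ((div_lt_one (by linarith)).2 (by linarith))).ne'
  field_simp

/-- The distribution with mass `ρ` at `z` that is uniform on the other states. -/
def pointedDist (ρ : ℝ) (z : Fin k) (j : Fin k) : ℝ := if j = z then ρ else (1 - ρ) / (k - 1)

theorem pointedDist_self (ρ : ℝ) (z : Fin k) : pointedDist ρ z z = ρ := if_pos rfl

theorem pointedDist_of_ne (ρ : ℝ) {z j : Fin k} (hj : j ≠ z) :
    pointedDist ρ z j = (1 - ρ) / (k - 1) := if_neg hj

theorem sum_pointedDist (hk : 2 ≤ k) (ρ : ℝ) (z : Fin k) : ∑ j, pointedDist ρ z j = 1 := by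
  have hk2 : (2 : ℝ) ≤ k := by exact_mod_cast hk
  have hk1 : (k : ℝ) - 1 ≠ 0 := by linarith
  rw [Fintype.sum_eq_add_sum_compl z, pointedDist_self,
    Finset.sum_congr rfl fun j hj => pointedDist_of_ne ρ (by simpa using hj)]
  simp only [Finset.sum_const, Finset.card_compl, Fintype.card_fin, Finset.card_singleton,
    nsmul_eq_mul, Nat.cast_pred (by omega : 0 < k)]
  field_simp
  ring

theorem exists_mem_chainClass_of_col_eq (hδρ : δ ≤ ρ) (hρ : 0 ≤ ρ) {b : Fin k → ℝ}
    (hb : b ∈ stdSimplex ℝ (Fin k)) {M : Fin k → Fin k → ℝ} (hM : ∀ i j, ρ ≤ M i j)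
    (hM1 : ∀ i, ∑ j, M i j = 1) {z : Fin k} (hz : ∀ i, M i z = ρ) :
    ∃ P ∈ chainClass k δ ρ, P.init = b ∧ P.prob = M := by
  have : Nonempty (Fin k) := ⟨z⟩
  have hstoch : Matrix.of M ∈ Matrix.rowStochastic ℝ (Fin k) :=
    Matrix.mem_rowStochastic_iff_sum.2 ⟨fun i j => hρ.trans (hM i j), hM1⟩
  obtain ⟨π, hπ, hπM⟩ := exists_vecMul_eq_of_mem_rowStochastic hstoch
  have hπj : ∀ j, ∑ i, π i * M i j = π j := congrFun hπM
  refine ⟨⟨b, Matrix.of M, π, hb, hstoch, hπ, hπM⟩,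
    ⟨fun i j => hδρ.trans (hM i j), ⟨z, ?_⟩, ?_⟩, rfl, rfl⟩
  · change π z = ρ
    rw [← hπj z]
    simp only [hz, ← Finset.sum_mul, hπ.2, one_mul]
  · rintro _ ⟨j, rfl⟩
    calc ρ = ∑ i, π i * ρ := by rw [← Finset.sum_mul, hπ.2, one_mul]
      _ ≤ ∑ i, π i * M i j :=
          Finset.sum_le_sum fun i _ => mul_le_mul_of_nonneg_left (hM i j) (hπ.1 i)
      _ = π j := hπj j

theorem isPerturbationFamily_pointed (hk : 2 ≤ k) (hδρ : δ ≤ ρ) (hρ : 0 < ρ)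
    (hρk : ρ < 1 / (k : ℝ)) (z : Fin k) :
    IsPerturbationFamily (chainClass k δ ρ) (pointedDist ρ z)
      (productDirection (fun i => Pi.single i 1) {z}ᶜ) := by
  have hk2 : (2 : ℝ) ≤ k := by exact_mod_cast hk
  have hρc : ρ < (1 - ρ) / (k - 1) := by
    rw [lt_div_iff₀ (by linarith)]
    rw [lt_div_iff₀ (by linarith)] at hρk
    linarith
  have hb : ∀ i, ρ ≤ pointedDist ρ z i := fun i => by
    unfold pointedDist
    split_ifs <;> linarith
  have hb0 : ∀ i, 0 < pointedDist ρ z i := fun i => hρ.trans_le (hb i)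
  have hsum := sum_pointedDist hk ρ z
  refine ⟨hb0, hsum, sum_productDirection _ _, ?_⟩
  filter_upwards [eventually_abs_perturbedKernel_sub_le (pointedDist ρ z)
    (productDirection (fun i => Pi.single i 1) {z}ᶜ) (sub_pos.2 hρc)] with θ hθ
  have hz : ∀ i, perturbedKernel (pointedDist ρ z)
      (productDirection (fun i => Pi.single i 1) {z}ᶜ) θ i z = ρ := fun i =>
    (perturbedKernel_productDirection_of_notMem (by simp) θ i).trans (pointedDist_self ρ z)
  refine exists_mem_chainClass_of_col_eq hδρ hρ.le ⟨fun i => (hb0 i).le, hsum⟩ (fun i j => ?_)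
    (sum_perturbedKernel hsum (sum_productDirection _ _) θ) hz
  rcases eq_or_ne j z with rfl | hj
  · exact (hz i).ge
  · have := (abs_le.1 (hθ i j)).1
    rw [pointedDist_of_ne ρ hj] at this
    linarith

theorem rowBound_pointed (hk : 3 ≤ k) (hρ1 : ρ < 1) (z i : Fin k) :
    rowBound (pointedDist ρ z) (productDirection (fun i => Pi.single i 1) {z}ᶜ) i =
      ((k : ℝ) - 2) / pointedDist ρ z i := by
  have hk3 : (3 : ℝ) ≤ k := by exact_mod_cast hk
  have hcard : ({z}ᶜ : Finset (Fin k)).card = k - 1 := by simp [Finset.card_compl]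
  have hsum : ∑ l, pointedDist ρ z l * (Pi.single i 1 : Fin k → ℝ) l ^ 2 = pointedDist ρ z i := by
    rw [Finset.sum_eq_single_of_mem i (Finset.mem_univ i) fun l _ hl => by simp [hl],
      Pi.single_eq_same, one_pow, mul_one]
  rw [rowBound_productDirection (c := (1 - ρ) / (k - 1)) (by omega)
    (div_pos (sub_pos.2 hρ1) (by linarith))
    (fun j hj => pointedDist_of_ne ρ (by simpa using hj)), hsum, Pi.single_eq_same, hcard,
    Nat.cast_pred (by omega)]
  ring

end PerturbationFamilies

section MinimaxBounds

variable {k n : ℕ} {δ ρ c A : ℝ} {f : ℝ → ℝ}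

theorem le_of_chainClass_nonempty (hne : (chainClass k δ ρ).Nonempty) : δ ≤ ρ := by
  obtain ⟨P, hP, ⟨i, hi⟩, -⟩ := hne
  calc δ = ∑ j, P.stat j * δ := by rw [← Finset.sum_mul, P.stat_mem.2, one_mul]
    _ ≤ ∑ j, P.stat j * P.prob j i :=
        Finset.sum_le_sum fun j _ => mul_le_mul_of_nonneg_left (hP j i) (P.stat_mem.1 j)
    _ = ρ := by rw [P.sum_stat_mul_prob, hi]

theorem pos_of_chainClass_nonempty (hne : (chainClass k δ ρ).Nonempty) : 0 < k := by
  obtain ⟨-, -, ⟨i, -⟩, -⟩ := hne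
  exact i.pos

theorem le_one_div_of_chainClass_nonempty (hne : (chainClass k δ ρ).Nonempty) :
    ρ ≤ 1 / (k : ℝ) := by
  have hk := pos_of_chainClass_nonempty hne
  obtain ⟨P, -, -, hmin⟩ := hne
  rw [le_div_iff₀ (Nat.cast_pos.2 hk), mul_comm]
  calc k * ρ = ∑ _ : Fin k, ρ := by simp
    _ ≤ ∑ i, P.stat i := Finset.sum_le_sum fun i _ => hmin ⟨i, rfl⟩
    _ = 1 := P.stat_mem.2

theorem exists_isPerturbationFamily_chainClass (hk : 3 ≤ k) (hδ : 0 < δ) (hδk : δ < 1 / (k : ℝ))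
    (hδρ : δ ≤ ρ) (hρk : ρ ≤ 1 / (k : ℝ)) :
    ∃ (b : Fin k → ℝ) (H : Fin k × Fin k → Fin k → Fin k → ℝ),
      IsPerturbationFamily (chainClass k δ ρ) b H ∧
      ((k : ℝ) - 2) * k ≤ ∑ i, b i * rowBound b H i ∧
      ∃ z, ((k : ℝ) - 2) / ρ ≤ rowBound b H z := by
  have hk3 : (3 : ℝ) ≤ k := by exact_mod_cast hk
  have hk0 : (k : ℝ) ≠ 0 := by positivity
  let z : Fin k := ⟨0, by omega⟩
  rcases hρk.lt_or_eq with hlt | rfl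
  · have hρ1 : ρ < 1 := hlt.trans_le (div_le_one_of_le₀ (by linarith) (by linarith))
    have hfam := isPerturbationFamily_pointed (by omega) hδρ (hδ.trans_le hδρ) hlt z
    refine ⟨_, _, hfam, ?_, z, ?_⟩
    · simp only [rowBound_pointed hk hρ1, mul_div_cancel₀ _ (hfam.pos _).ne', Finset.sum_const,
        Finset.card_univ, Fintype.card_fin, nsmul_eq_mul, mul_comm _ (k : ℝ), le_refl]
    · rw [rowBound_pointed hk hρ1, pointedDist_self]
  · have hrow := rowBound_uniform (by omega : 2 ≤ k)
    have hsq : ((k : ℝ) - 2) * k ≤ (k - 1) ^ 2 := by linarith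
    refine ⟨_, _, isPerturbationFamily_uniform (by omega) hδ hδk, ?_, z, ?_⟩
    · simp only [hrow, ← Finset.sum_mul, Finset.sum_const, Finset.card_univ, Fintype.card_fin,
        nsmul_eq_mul, mul_one_div_cancel hk0, one_mul, hsq]
    · rwa [hrow, div_div_eq_mul_div, div_one]

theorem HasConvexExpansion.asympLE_minimax_chainClass (hf : HasConvexExpansion f c A)
    (hδ : 0 < δ) (hδk : δ < 1 / (k : ℝ)) (hne : (chainClass k δ ρ).Nonempty) :
    AsympLE (fun n => ((max (((k : ℝ) - 2) * k * A / (2 * n)) 0 : ℝ) : EReal))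
        (minimaxWeighted (fDiv f) (chainClass k δ ρ)) ∧
      AsympLE (fun n => ((max (((k : ℝ) - 2) * A / (2 * n * ρ)) 0 : ℝ) : EReal))
        (minimaxWorst (fDiv f) (chainClass k δ ρ)) := by
  have hA := hf.pos
  have hρ : 0 < ρ := hδ.trans_le (le_of_chainClass_nonempty hne)
  have hS0 : ∀ P ∈ chainClass k δ ρ, ∀ i j, 0 < P.prob i j := fun P hP i j =>
    hδ.trans_le (hP.1 i j)
  rcases Nat.lt_or_ge k 3 with hk | hk
  · have : Nonempty (Fin k) := ⟨⟨0, pos_of_chainClass_nonempty hne⟩⟩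
    have hk2 : (k : ℝ) - 2 ≤ 0 := sub_nonpos.2 (by exact_mod_cast Nat.le_of_lt_succ hk)
    obtain ⟨P, hP⟩ := hne
    refine ⟨.of_le fun n => ?_, .of_le fun n => ?_⟩
    · rw [max_eq_right (div_nonpos_of_nonpos_of_nonneg (mul_nonpos_of_nonpos_of_nonneg
        (mul_nonpos_of_nonpos_of_nonneg hk2 (by positivity)) hA.le) (by positivity))]
      exact hf.minimaxWeighted_nonneg hP (hS0 P hP)
    · rw [max_eq_right (div_nonpos_of_nonpos_of_nonneg
        (mul_nonpos_of_nonpos_of_nonneg hk2 hA.le) (by positivity))]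
      exact hf.minimaxWorst_nonneg hP (hS0 P hP)
  · have hk2 : (0 : ℝ) ≤ (k : ℝ) - 2 := by
      have : (3 : ℝ) ≤ k := by exact_mod_cast hk
      linarith
    obtain ⟨b, H, hfam, hsum, z, hz⟩ := exists_isPerturbationFamily_chainClass hk hδ hδk
      (le_of_chainClass_nonempty hne) (le_one_div_of_chainClass_nonempty hne)
    refine ⟨(hf.asympLE_minimaxWeighted hS0 hfam).mono_left fun n => EReal.coe_le_coe ?_,
      (hf.asympLE_minimaxWorst hS0 hfam z).mono_left fun n => EReal.coe_le_coe ?_⟩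
    · rw [max_eq_left (by positivity)]
      calc ((k : ℝ) - 2) * k * A / (2 * n) = A / (2 * n) * (((k : ℝ) - 2) * k) := by ring
        _ ≤ _ := by gcongr
    · rw [max_eq_left (by positivity)]
      calc ((k : ℝ) - 2) * A / (2 * n * ρ) = A / (2 * n) * (((k : ℝ) - 2) / ρ) := by field_simp
        _ ≤ _ := by gcongr

theorem HasConvexExpansion.fDiv_self (hf : HasConvexExpansion f c A) (p : Fin k → ℝ) :
    fDiv f p p = 0 := by
  refine Finset.sum_eq_zero fun i _ => ?_
  have hone : f 1 = 0 := by simpa [tangentGap] using hf.tangentGap_one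
  rcases eq_or_ne (p i) 0 with hi | hi
  · simp [fDivTerm, hi]
  · simp [fDivTerm, hi, hone]

theorem HasConvexExpansion.stateRisk_eq_zero (hf : HasConvexExpansion f c A) (P : MarkovModel 1)
    (E : Estimator n 1) (i : Fin 1) : stateRisk (fDiv f) P E i = 0 := by
  refine Finset.sum_eq_zero fun x _ => ?_
  have hrow : P.trans i = (E x).1 i :=
    congrArg Subtype.val (Subsingleton.elim (⟨_, P.prob_mem_stdSimplex i⟩ : stdSimplex ℝ (Fin 1))
      ⟨_, rowStochastic_row_mem_stdSimplex (E x) i⟩)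
  rw [hrow, hf.fDiv_self, mul_zero]

theorem HasConvexExpansion.minimaxWeighted_chainClass_asympLE (hf : HasConvexExpansion f c A)
    (hδ : 0 < δ) (hne : (chainClass k δ ρ).Nonempty) :
    AsympLE (minimaxWeighted (fDiv f) (chainClass k δ ρ))
      (fun n => ((((k : ℝ) - 1) * k * A / (2 * n) : ℝ) : EReal)) := by
  rcases (Nat.succ_le_of_lt (pos_of_chainClass_nonempty hne)).eq_or_lt with rfl | hk
  · refine .of_le fun n => (iInf_le _ fun _ => 1).trans (iSup₂_le fun P _ => ?_)
    simp [weightedRisk, hf.stateRisk_eq_zero]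
  · exact hf.minimaxWeighted_asympLE hk hδ (hδ.trans_le (le_of_chainClass_nonempty hne))

theorem HasConvexExpansion.minimaxWorst_chainClass_asympLE (hf : HasConvexExpansion f c A)
    (hδ : 0 < δ) (hne : (chainClass k δ ρ).Nonempty) :
    AsympLE (minimaxWorst (fDiv f) (chainClass k δ ρ))
      (fun n => ((((k : ℝ) - 1) * A / (2 * n * ρ) : ℝ) : EReal)) := by
  rcases (Nat.succ_le_of_lt (pos_of_chainClass_nonempty hne)).eq_or_lt with rfl | hk
  · refine .of_le fun n => (iInf_le _ fun _ => 1).trans (iSup₂_le fun P _ => ?_)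
    simp [worstRisk, hf.stateRisk_eq_zero]
  · exact hf.minimaxWorst_asympLE hk hδ (hδ.trans_le (le_of_chainClass_nonempty hne))

end MinimaxBounds

end

theorem theorem3_general {k : ℕ} {δ ρ c A : ℝ} {f : ℝ → ℝ} (hf : HasConvexExpansion f c A)
    (hδ : 0 < δ) (hδk : δ < 1 / (k : ℝ)) (hne : (chainClass k δ ρ).Nonempty) :
    (AsympLE (fun n => ((max (((k : ℝ) - 2) * k * A / (2 * n)) 0 : ℝ) : EReal))
        (minimaxWeighted (fDiv f) (chainClass k δ ρ)) ∧
      AsympLE (minimaxWeighted (fDiv f) (chainClass k δ ρ))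
        (fun n => ((((k : ℝ) - 1) * k * A / (2 * n) : ℝ) : EReal))) ∧
    (AsympLE (fun n => ((max (((k : ℝ) - 2) * A / (2 * n * ρ)) 0 : ℝ) : EReal))
        (minimaxWorst (fDiv f) (chainClass k δ ρ)) ∧
      AsympLE (minimaxWorst (fDiv f) (chainClass k δ ρ))
        (fun n => ((((k : ℝ) - 1) * A / (2 * n * ρ) : ℝ) : EReal))) :=
  have hlower := hf.asympLE_minimax_chainClass hδ hδk hne
  ⟨⟨hlower.1, hf.minimaxWeighted_chainClass_asympLE hδ hne⟩,
    hlower.2, hf.minimaxWorst_chainClass_asympLE hδ hne⟩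

theorem theorem3 (k : ℕ) (δ ρ : ℝ) (hδ : 0 < δ) (hδk : δ < 1 / (k : ℝ))
    (hρ : 0 < ρ) (hρk : ρ ≤ 1 / (k : ℝ)) (hne : (chainClass k δ ρ).Nonempty)
    (f : ℝ → ℝ) (hf : IsOrdinary f) :
    (AsympLE
        (fun n => (((1 - ρ) * (((k : ℝ) - 2) * k * iteratedDeriv 2 f 1 / (2 * n)) : ℝ) : EReal))
        (minimaxWeighted (fDiv f) (chainClass k δ ρ)) ∧
      AsympLE (minimaxWeighted (fDiv f) (chainClass k δ ρ))
        (fun n => ((((k : ℝ) - 1) * k * iteratedDeriv 2 f 1 / (2 * n) : ℝ) : EReal))) ∧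
    (AsympLE
        (fun n => (((1 - ρ) * (((k : ℝ) - 2) * iteratedDeriv 2 f 1 / (2 * n * ρ)) : ℝ) : EReal))
        (minimaxWorst (fDiv f) (chainClass k δ ρ)) ∧
      AsympLE (minimaxWorst (fDiv f) (chainClass k δ ρ))
        (fun n => ((((k : ℝ) - 1) * iteratedDeriv 2 f 1 / (2 * n * ρ) : ℝ) : EReal))) := by
  have hρ1 : ρ ≤ 1 := hρk.trans (sub_nonneg.1 (Nat.one_sub_one_div_cast_nonneg k))
  obtain ⟨⟨hweighted, hweighted'⟩, hworst, hworst'⟩ :=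
    theorem3_general hf.hasConvexExpansion hδ hδk hne
  exact ⟨⟨hweighted.one_sub_mul hρ.le hρ1, hweighted'⟩, hworst.one_sub_mul hρ.le hρ1, hworst'⟩
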